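/- Let $R_{m,n}=\mathbb{C}[z_{ij}]_{1\le i\le m,\,1\le j\le n}$. For $\alpha\in\mathrm{Mat}_{m,n}(\mathbb{N})$ put $z^\alpha=\prod_{i,j}z_{ij}^{\alpha_{ij}}$, and let $\mathrm{RSK}(\alpha)=(P,Q)$ be the pair of semistandard tableaux of the same shape that the Robinson–Schensted–Knuth correspondence associates with $\alpha$: reading the entries of $\alpha$ down the columns, the columns from left to right, each entry $\alpha_{ij}$ contributes $\alpha_{ij}$ biletters $(i|j)$; these are inserted successively, starting with the empty pair, where inserting $(p|q)$ means row inserting $p$ in $P$ and putting $q$ in $Q$ at the position of the new box of $P$. Let $[P|Q]\in R_{m,n}$ be the product, over all $c$, of the minors of the generic matrix $(z_{ij})$ whose row indices form the $c$-th column of $P$ and whose column indices form the $c$-th column of $Q$. Let $\mathsf{RSK}:R_{m,n}\to R_{m,n}$ be the $\mathbb{C}$-linear operator with $\mathsf{RSK}(z^\alpha)=[P|Q]$, where $(P,Q)=\mathrm{RSK}(\alpha)$. For $\sigma\in\mathbb{N}^m$ and $\pi\in\mathbb{N}^n$ let $\mathsf{Cont}_{\sigma,\pi}$ be the set of all $\alpha\in\mathrm{Mat}_{m,n}(\mathbb{N})$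 with row sums $\sigma$ and column sums $\pi$, let $R_{\sigma,\pi}$ be the span of the $z^\alpha$ with $\alpha\in\mathsf{Cont}_{\sigma,\pi}$, which is mapped to itself by $\mathsf{RSK}$, and let $\mathsf{RSK}_{\sigma,\pi}:R_{\sigma,\pi}\to R_{\sigma,\pi}$ be the restriction of $\mathsf{RSK}$. **Proposition.** Let $(\sigma,\pi)\in\mathbb{N}^m\times\mathbb{N}^n$ be a reduced pair of degree $d$, i.e. $\sum_i\sigma_i=\sum_j\pi_j=d$ and $\max_i\sigma_i+\max_j\pi_j\le d$ (the maximum of an empty family being $0$). Then: 1. every rational eigenvalue of $\mathsf{RSK}_{\sigma,\pi}$ is $1$ or $-1$; 2. $1$ is an eigenvalue of $\mathsf{RSK}_{\sigma,\pi}$. More precisely, there is exactly one $\alpha^0\in\mathsf{Cont}_{\sigma,\pi}$ (the canonical contingency table) such that the tableaux of $\mathrm{RSK}(\alpha^0)$ have one row (or no row at all, if $d=0$), and $z^{\alpha^0}$ is an eigenvector of $\mathsf{RSK}_{\sigma,\pi}$ with eigenvalue $1$. -/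

import Mathlib

namespace RSKOp

/-! ### The Robinson-Schensted-Knuth correspondence

A (filling of a) Young tableau is given by the list of its rows, from top to bottom, each row being
the list of its labels from left to right. The label set `{1, ..., m}` is modelled by `Fin m`. -/

/-- Insertion of `p` in a weakly increasing row: if no label of the row exceeds `p`, then `p` is put
at the end of the row and nothing is bumped; otherwise `p` replaces the leftmost label exceeding `p`
(for a weakly increasing row, this is the leftmost copy of the smallest such label), and that label
is bumped. The result is the new row together with the bumped label, if there is one. -/
def insertRow {m : ℕ} (p : Fin m) : List (Fin m) → List (Fin m) × Option (Fin m)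
  | [] => ([p], none)
  | x :: R => if p < x then (p :: R, some x) else (x :: (insertRow p R).1, (insertRow p R).2)

/-- Row insertion of `p` in a tableau. The result is the new tableau together with the index
(counted from `0`) of the row in which the new box has been created. -/
def insertTableau {m : ℕ} : Fin m → List (List (Fin m)) → List (List (Fin m)) × ℕ
  | p, [] => ([[p]], 0)
  | p, R :: T =>
    match insertRow p R with
    | (R', none) => (R' :: T, 0)
    | (R', some x) => (R' :: (insertTableau x T).1, (insertTableau x T).2 + 1)

/-- Put a new box with label `q` at the end of the row with index `k` (a new row if there is no row
with index `k`). -/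
def addBox {n : ℕ} (q : Fin n) : ℕ → List (List (Fin n)) → List (List (Fin n))
  | _, [] => [[q]]
  | 0, R :: T => (R ++ [q]) :: T
  | k + 1, R :: T => R :: addBox q k T

/-- Insertion of the biletter `b = (p|q)` in a pair `(P, Q)` of tableaux of the same shape: `p` is
row inserted in `P`, and `q` is put in `Q` where the new box of `P` has been created. -/
def insertBiletter {m n : ℕ} (PQ : List (List (Fin m)) × List (List (Fin n)))
    (b : Fin m × Fin n) : List (List (Fin m)) × List (List (Fin n)) :=
  ((insertTableau b.1 PQ.1).1, addBox b.2 (insertTableau b.1 PQ.1).2 PQ.2)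

/-- `m × n` matrices with entries in `ℕ`, as exponents of monomials in the variables `z i j`; the
entry in row `i` and column `j` of `α` is `α (i, j)`. -/
abbrev ExpMat (m n : ℕ) : Type := (Fin m × Fin n) →₀ ℕ

/-- The biword of `α`: the entries are read down the columns, the columns are taken from left to
right, and the entry in row `i` and column `j` contributes `α (i, j)` copies of `(i|j)`. -/
def biword {m n : ℕ} (α : ExpMat m n) : List (Fin m × Fin n) :=
  (List.finRange n).flatMap fun j =>
    (List.finRange m).flatMap fun i => List.replicate (α (i, j)) (i, j)

/-- The Robinson-Schensted-Knuth correspondence `α ↦ (P, Q)`: the biletters of the biword of `α`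
are inserted successively, starting with the pair of empty tableaux. -/
def rsk {m n : ℕ} (α : ExpMat m n) : List (List (Fin m)) × List (List (Fin n)) :=
  (biword α).foldl insertBiletter ([], [])

/-! ### Bitableaux -/

/-- The number of columns of a tableau. -/
def width {m : ℕ} (T : List (List (Fin m))) : ℕ := (T.map List.length).foldr max 0

/-- The column with index `c` (counted from `0`) of a tableau, from top to bottom. -/
def column {m : ℕ} (T : List (List (Fin m))) (c : ℕ) : List (Fin m) :=
  T.filterMap fun R => R[c]?

/-- The minor of the generic `m × n` matrix whose row indices are listed in `u` and whose column
indices are listed in `v`. It is used only for lists of the same length, and is `0` otherwise. -/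
noncomputable def minor {m n : ℕ} (u : List (Fin m)) (v : List (Fin n)) :
    MvPolynomial (Fin m × Fin n) ℂ :=
  if h : u.length = v.length then
    Matrix.det (Matrix.of fun a b : Fin u.length =>
      (MvPolynomial.X (u.get a, v.get (Fin.cast h b)) : MvPolynomial (Fin m × Fin n) ℂ))
  else 0

/-- The bitableau `[P|Q]`: the product, over the columns, of the minors whose row indices and column
indices are in the respective columns of `P` and `Q`. -/
noncomputable def bitableau {m n : ℕ} (PQ : List (List (Fin m)) × List (List (Fin n))) :
    MvPolynomial (Fin m × Fin n) ℂ :=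
  ∏ c ∈ Finset.range (width PQ.1), minor (column PQ.1 c) (column PQ.2 c)

/-! ### The linear operator and the weight spaces -/

/-- The linear operator on the coordinate ring of `m × n` complex matrices that extends
`z ^ α ↦ [P|Q]`, where `(P, Q)` corresponds to `α`. -/
noncomputable def rskOp (m n : ℕ) : Module.End ℂ (MvPolynomial (Fin m × Fin n) ℂ) :=
  (MvPolynomial.basisMonomials (Fin m × Fin n) ℂ).constr ℂ fun α => bitableau (rsk α)

/-- `α` is a contingency table with row margins `σ` and column margins `π`. -/
def IsCont {m n : ℕ} (σ : Fin m → ℕ) (π : Fin n → ℕ) (α : ExpMat m n) : Prop :=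
  (∀ i, ∑ j, α (i, j) = σ i) ∧ (∀ j, ∑ i, α (i, j) = π j)

/-- The weight space spanned by the monomials of the contingency tables with margins `σ`, `π`. -/
noncomputable def weightSpace {m n : ℕ} (σ : Fin m → ℕ) (π : Fin n → ℕ) :
    Submodule ℂ (MvPolynomial (Fin m × Fin n) ℂ) :=
  Submodule.span ℂ {f | ∃ α : ExpMat m n, IsCont σ π α ∧ f = MvPolynomial.monomial α 1}

/-! ### Helper facts: the operator preserves the weight spaces -/

theorem insertRow_perm {m : ℕ} (p : Fin m) (R : List (Fin m)) :
    ((insertRow p R).2.toList ++ (insertRow p R).1).Perm (p :: R) := by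
  induction R with
  | nil => simp [insertRow]
  | cons x R ih =>
    unfold insertRow
    split_ifs with h
    · exact List.Perm.swap _ _ _
    · exact List.perm_middle.trans ((ih.cons x).trans (List.Perm.swap _ _ _))

theorem insertTableau_perm {m : ℕ} (p : Fin m) (T : List (List (Fin m))) :
    (insertTableau p T).1.flatten.Perm (p :: T.flatten) := by
  induction T generalizing p with
  | nil => simp [insertTableau]
  | cons R T ih =>
    have hR := insertRow_perm p R
    unfold insertTableau
    split
    · next R' h =>
      rw [h] at hR
      simpa using hR.append_right T.flatten
    · next R' x h =>
      rw [h] at hR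
      have h1 : (R' ++ (insertTableau x T).1.flatten).Perm (x :: (R' ++ T.flatten)) :=
        ((ih x).append_left R').trans List.perm_middle
      have h2 := hR.append_right T.flatten
      simpa using h1.trans (by simpa using h2)

theorem addBox_perm {n : ℕ} (q : Fin n) (k : ℕ) (T : List (List (Fin n))) :
    (addBox q k T).flatten.Perm (q :: T.flatten) := by
  induction T generalizing k with
  | nil => cases k <;> simp [addBox]
  | cons R T ih =>
    cases k with
    | zero => simp [addBox]
    | succ k =>
      simpa [addBox] using ((ih k).append_left R).trans List.perm_middle

theorem insertRow_length {m : ℕ} (p : Fin m) (R : List (Fin m)) :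
    (insertRow p R).1.length = R.length + (if (insertRow p R).2.isNone then 1 else 0) := by
  have h := (insertRow_perm p R).length_eq
  cases h' : (insertRow p R).2 <;> simp [h'] at h ⊢ <;> omega

/-- The two tableaux keep the same shape. -/
theorem shape_insert {m n : ℕ} (p : Fin m) (q : Fin n) (T : List (List (Fin m)))
    (S : List (List (Fin n))) (h : T.map List.length = S.map List.length) :
    (insertTableau p T).1.map List.length
      = (addBox q (insertTableau p T).2 S).map List.length := by
  induction T generalizing p S with
  | nil =>
    cases S with
    | nil => simp [insertTableau, addBox]
    | cons => simp at h
  | cons R T ih =>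
    cases S with
    | nil => simp at h
    | cons R₂ S =>
      simp only [List.map_cons, List.cons.injEq] at h
      have hR := insertRow_length p R
      unfold insertTableau
      split
      · next R' hh =>
        rw [hh] at hR
        simp [addBox] at hR ⊢
        exact ⟨by omega, h.2⟩
      · next R' x hh =>
        rw [hh] at hR
        simp [addBox] at hR ⊢
        exact ⟨by omega, by simpa using ih x S h.2⟩

theorem foldl_insert {m n : ℕ} (w : List (Fin m × Fin n))
    (PQ : List (List (Fin m)) × List (List (Fin n)))
    (h : PQ.1.map List.length = PQ.2.map List.length) :
    ((w.foldl insertBiletter PQ).1.map List.length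
      = (w.foldl insertBiletter PQ).2.map List.length) ∧
    (w.foldl insertBiletter PQ).1.flatten.Perm (w.map Prod.fst ++ PQ.1.flatten) ∧
    (w.foldl insertBiletter PQ).2.flatten.Perm (w.map Prod.snd ++ PQ.2.flatten) := by
  induction w generalizing PQ with
  | nil => simp [h]
  | cons b w ih =>
    obtain ⟨h1, h2, h3⟩ := ih (insertBiletter PQ b) (shape_insert _ _ _ _ h)
    refine ⟨h1, h2.trans ?_, h3.trans ?_⟩
    · simpa [insertBiletter] using ((insertTableau_perm b.1 PQ.1).append_left _).trans List.perm_middle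
    · simpa [insertBiletter] using ((addBox_perm b.2 _ PQ.2).append_left _).trans List.perm_middle

theorem count_fst_biword {m n : ℕ} (α : ExpMat m n) (i : Fin m) :
    ((biword α).map Prod.fst).count i = ∑ j, α (i, j) := by
  simp only [biword, List.map_flatMap, List.count_flatMap, List.map_replicate,
    List.count_replicate, Function.comp_def, beq_iff_eq]
  rw [← List.ofFn_eq_map, List.sum_ofFn]
  refine Finset.sum_congr rfl fun j _ => ?_
  rw [← List.ofFn_eq_map, List.sum_ofFn]
  simp

theorem count_snd_biword {m n : ℕ} (α : ExpMat m n) (j : Fin n) :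
    ((biword α).map Prod.snd).count j = ∑ i, α (i, j) := by
  simp only [biword, List.map_flatMap, List.count_flatMap, List.map_replicate,
    List.count_replicate, Function.comp_def, beq_iff_eq]
  rw [← List.ofFn_eq_map, List.sum_ofFn, Finset.sum_eq_single j]
  · rw [← List.ofFn_eq_map, List.sum_ofFn]
    simp
  · intro b _ hb
    rw [← List.ofFn_eq_map, List.sum_ofFn]
    simp [hb]
  · simp

theorem count_column {m : ℕ} (T : List (List (Fin m))) (i : Fin m) (N : ℕ) (hN : width T ≤ N) :
    ∑ c ∈ Finset.range N, (column T c).count i = T.flatten.count i := by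
  induction T with
  | nil => simp [column]
  | cons R T ih =>
    have hw : R.length ≤ N ∧ width T ≤ N := by simpa [width] using hN
    have key : ∀ c, (column (R :: T) c).count i = (R[c]?).toList.count i + (column T c).count i := by
      intro c
      unfold column
      cases h : R[c]? <;> simp [h, List.count_cons, add_comm]
    have hR : ∀ (R : List (Fin m)) (N : ℕ), R.length ≤ N →
        ∑ c ∈ Finset.range N, (R[c]?).toList.count i = R.count i := by
      intro R
      induction R with
      | nil => intro N _; simp
      | cons x R ihR =>
        intro N hN
        obtain ⟨N, rfl⟩ : ∃ M, N = M + 1 := ⟨N - 1, by simp at hN; omega⟩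
        rw [Finset.sum_range_succ']
        simp only [List.getElem?_cons_succ, List.getElem?_cons_zero]
        rw [ihR N (by simpa using hN)]
        simp [List.count_cons]
    simp only [key, Finset.sum_add_distrib, ih hw.2, hR R N hw.1, List.flatten_cons,
      List.count_append]

/-- The torus weight of the variable `z i j`. -/
def varWeight (m n : ℕ) (x : Fin m × Fin n) : (Fin m → ℕ) × (Fin n → ℕ) :=
  (Pi.single x.1 1, Pi.single x.2 1)

theorem isCont_iff {m n : ℕ} (σ : Fin m → ℕ) (π : Fin n → ℕ) (α : ExpMat m n) :
    IsCont σ π α ↔ Finsupp.weight (varWeight m n) α = (σ, π) := by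
  have h : Finsupp.weight (varWeight m n) α
      = ((fun i => ∑ j, α (i, j)), (fun j => ∑ i, α (i, j))) := by
    rw [Finsupp.weight_apply, Finsupp.sum_fintype _ _ (by simp)]
    ext k
    · simp [varWeight, Prod.fst_sum, Fintype.sum_prod_type, Pi.single_apply, Finset.sum_apply]
    · simp [varWeight, Prod.snd_sum, Fintype.sum_prod_type, Pi.single_apply, Finset.sum_apply]
  rw [h, Prod.ext_iff, funext_iff, funext_iff]
  rfl

theorem mem_weightSpace_of {m n : ℕ} {σ : Fin m → ℕ} {π : Fin n → ℕ}
    {f : MvPolynomial (Fin m × Fin n) ℂ}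
    (hf : MvPolynomial.IsWeightedHomogeneous (varWeight m n) f (σ, π)) : f ∈ weightSpace σ π := by
  rw [f.as_sum]
  refine Submodule.sum_mem _ fun α hα => ?_
  have h : (MvPolynomial.monomial α (f.coeff α) : MvPolynomial (Fin m × Fin n) ℂ)
      = f.coeff α • MvPolynomial.monomial α 1 := by
    rw [MvPolynomial.smul_monomial, smul_eq_mul, mul_one]
  rw [h]
  exact Submodule.smul_mem _ _ (Submodule.subset_span
    ⟨α, (isCont_iff σ π α).2 (hf (MvPolynomial.mem_support_iff.1 hα)), rfl⟩)

theorem sum_varWeight {m n : ℕ} {k : ℕ} (u : Fin k → Fin m) (v : Fin k → Fin n) :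
    ∑ a, varWeight m n (u a, v a)
      = ((fun i => (List.ofFn u).count i), (fun j => (List.ofFn v).count j)) := by
  have h : ∀ {r : ℕ} (w : Fin k → Fin r) (i : Fin r),
      ∑ a, (Pi.single (w a) 1 : Fin r → ℕ) i = (List.ofFn w).count i := by
    intro r w i
    have : (List.ofFn w).count i = (Multiset.map w Finset.univ.val).count i := by
      rw [← Multiset.coe_count]
      congr 1
      simp [List.ofFn_eq_map, Fin.univ_val_map]
    rw [this, Multiset.count_map]
    simp only [Pi.single_apply, Finset.sum_boole, Nat.cast_id]
    rfl
  ext i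
  · simpa [varWeight, Prod.fst_sum, Finset.sum_apply] using h u i
  · simpa [varWeight, Prod.snd_sum, Finset.sum_apply] using h v i

theorem minor_weight {m n : ℕ} (u : List (Fin m)) (v : List (Fin n)) :
    MvPolynomial.IsWeightedHomogeneous (varWeight m n) (minor u v)
      ((fun i => u.count i), (fun j => v.count j)) := by
  unfold minor
  split_ifs with h
  · rw [Matrix.det_apply]
    refine MvPolynomial.IsWeightedHomogeneous.sum _ _ _ fun s _ => ?_
    have hp := MvPolynomial.IsWeightedHomogeneous.prod (R := ℂ) (w := varWeight m n) Finset.univ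
      (fun a : Fin u.length => (MvPolynomial.X (u.get (s a), v.get (Fin.cast h a)) :
        MvPolynomial (Fin m × Fin n) ℂ)) _
      (fun a _ => MvPolynomial.isWeightedHomogeneous_X ℂ (varWeight m n) _)
    rw [sum_varWeight (fun a => u.get (s a)) (fun a => v.get (Fin.cast h a))] at hp
    have hu : (List.ofFn fun a => u.get (s a)).Perm u := by
      have := Equiv.Perm.ofFn_comp_perm s u.get
      simpa [Function.comp_def] using this
    have hv : (List.ofFn fun a => v.get (Fin.cast h a)) = v := by
      apply List.ext_get
      · simp [h]
      · intro k h1 h2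
        simp
    rw [hv] at hp
    simp only [hu.count_eq] at hp
    have := (MvPolynomial.weightedHomogeneousSubmodule ℂ (varWeight m n) _).smul_mem
      (((Equiv.Perm.sign s : ℤˣ) : ℤ) : ℂ) hp
    rw [MvPolynomial.mem_weightedHomogeneousSubmodule] at this
    convert this using 1
    rcases Int.units_eq_one_or (Equiv.Perm.sign s) with h' | h' <;> simp [h', Units.smul_def]
  · exact MvPolynomial.isWeightedHomogeneous_zero _ _ _

theorem bitableau_rsk_mem {m n : ℕ} {σ : Fin m → ℕ} {π : Fin n → ℕ} {α : ExpMat m n}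
    (hα : IsCont σ π α) : bitableau (rsk α) ∈ weightSpace σ π := by
  apply mem_weightSpace_of
  obtain ⟨h1, h2, h3⟩ := foldl_insert (biword α) ([], []) rfl
  change (rsk α).1.map _ = (rsk α).2.map _ at h1
  change (rsk α).1.flatten.Perm _ at h2
  change (rsk α).2.flatten.Perm _ at h3
  have hp := MvPolynomial.IsWeightedHomogeneous.prod (R := ℂ) (w := varWeight m n)
    (Finset.range (width (rsk α).1))
    (fun c => minor (column (rsk α).1 c) (column (rsk α).2 c)) _ (fun c _ => minor_weight _ _)
  have hw : width (rsk α).2 = width (rsk α).1 := by simp [width, h1]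
  have hsum : (σ, π) = ∑ c ∈ Finset.range (width (rsk α).1),
      ((fun i => (column (rsk α).1 c).count i), (fun j => (column (rsk α).2 c).count j)) := by
    ext k
    · simp only [Prod.fst_sum, Finset.sum_apply]
      rw [count_column _ _ _ le_rfl, h2.count_eq, ← hα.1 k, ← count_fst_biword]
      simp
    · simp only [Prod.snd_sum, Finset.sum_apply]
      rw [count_column _ _ _ hw.le, h3.count_eq, ← hα.2 k, ← count_snd_biword]
      simp
  rw [hsum]
  exact hp

theorem rskOp_mem {m n : ℕ} (σ : Fin m → ℕ) (π : Fin n → ℕ) :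
    ∀ f ∈ weightSpace σ π, rskOp m n f ∈ weightSpace σ π := by
  intro f hf
  induction hf using Submodule.span_induction with
  | mem f h =>
    obtain ⟨α, hα, rfl⟩ := h
    have : rskOp m n (MvPolynomial.monomial α 1) = bitableau (rsk α) := by
      have := (MvPolynomial.basisMonomials (Fin m × Fin n) ℂ).constr_basis ℂ
        (fun α => bitableau (rsk α)) α
      simpa [rskOp] using this
    rw [this]
    exact bitableau_rsk_mem hα
  | zero => simp
  | add x y _ _ hx hy => rw [map_add]; exact Submodule.add_mem _ hx hy
  | smul c x _ hx => rw [map_smul]; exact Submodule.smul_mem _ _ hx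

/-! ### The restricted operator, reduced pairs, the canonical contingency table -/

/-- The restriction of the operator to the weight space with margins `σ`, `π`. -/
noncomputable def rskWeight {m n : ℕ} (σ : Fin m → ℕ) (π : Fin n → ℕ) :
    Module.End ℂ (weightSpace σ π) :=
  (rskOp m n).restrict (rskOp_mem σ π)

/-- The monomial of a contingency table, as an element of the weight space. -/
noncomputable def contMonomial {m n : ℕ} {σ : Fin m → ℕ} {π : Fin n → ℕ} (α : ExpMat m n)
    (hα : IsCont σ π α) : weightSpace σ π :=
  ⟨MvPolynomial.monomial α 1, Submodule.subset_span ⟨α, hα, rfl⟩⟩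

/-- `(σ, π)` is a weight pair of degree `d`, and it is reduced: the largest entry of `σ` plus the
largest entry of `π` is at most `d`. -/
structure IsReducedPair {m n : ℕ} (d : ℕ) (σ : Fin m → ℕ) (π : Fin n → ℕ) : Prop where
  sum_left : ∑ i, σ i = d
  sum_right : ∑ j, π j = d
  max_add_max_le : Finset.univ.sup σ + Finset.univ.sup π ≤ d

/-- `α` is a contingency table with margins `σ`, `π` whose pair of tableaux has only one row
(no row at all in degree `0`). -/
def IsCanonical {m n : ℕ} (σ : Fin m → ℕ) (π : Fin n → ℕ) (α : ExpMat m n) : Prop :=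
  IsCont σ π α ∧ (rsk α).1.length ≤ 1 ∧ (rsk α).2.length ≤ 1

end RSKOp

namespace RSKOp

/-! ### Row insertion -/

theorem insertRow_of_forall_le {m : ℕ} {p : Fin m} {R : List (Fin m)} (h : ∀ x ∈ R, x ≤ p) :
    insertRow p R = (R ++ [p], none) := by
  induction R with
  | nil => rfl
  | cons r R ih =>
    simp only [List.mem_cons, forall_eq_or_imp] at h
    simp [insertRow, not_lt.2 h.1, ih h.2]

theorem forall_le_of_insertRow_snd_eq_none {m : ℕ} {p : Fin m} {R : List (Fin m)}
    (h : (insertRow p R).2 = none) : ∀ x ∈ R, x ≤ p := by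
  induction R with
  | nil => simp
  | cons r R ih =>
    unfold insertRow at h
    split_ifs at h with hp
    simp only [List.mem_cons, forall_eq_or_imp]
    exact ⟨not_lt.1 hp, ih h⟩

theorem insertRow_fst_of_snd_eq_none {m : ℕ} {p : Fin m} {R : List (Fin m)}
    (h : (insertRow p R).2 = none) : (insertRow p R).1 = R ++ [p] := by
  rw [insertRow_of_forall_le (forall_le_of_insertRow_snd_eq_none h)]

theorem lt_of_insertRow_snd_eq_some {m : ℕ} {p x : Fin m} {R : List (Fin m)}
    (h : (insertRow p R).2 = some x) : p < x := by
  induction R with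
  | nil => simp [insertRow] at h
  | cons r R ih =>
    unfold insertRow at h
    split_ifs at h with hp
    · simpa using (Option.some.inj h) ▸ hp
    · exact ih h

theorem mem_of_insertRow_snd_eq_some {m : ℕ} {p x : Fin m} {R : List (Fin m)}
    (h : (insertRow p R).2 = some x) : x ∈ R := by
  induction R with
  | nil => simp [insertRow] at h
  | cons r R ih =>
    unfold insertRow at h
    split_ifs at h with hp
    · simp only [Option.some.injEq] at h
      simp [h]
    · exact List.mem_cons_of_mem _ (ih h)

theorem mem_insertRow_self {m : ℕ} (p : Fin m) (R : List (Fin m)) : p ∈ (insertRow p R).1 := by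
  induction R with
  | nil => simp [insertRow]
  | cons r R ih =>
    unfold insertRow
    split_ifs with hp
    · simp
    · simp [ih]

theorem mem_or_eq_of_mem_insertRow {m : ℕ} {p y : Fin m} {R : List (Fin m)}
    (h : y ∈ (insertRow p R).1) : y = p ∨ y ∈ R := by
  have := (insertRow_perm p R).subset (List.mem_append_right _ h)
  simpa using this

theorem insertRow_ne_nil {m : ℕ} (p : Fin m) (R : List (Fin m)) : (insertRow p R).1 ≠ [] :=
  List.ne_nil_of_mem (mem_insertRow_self p R)

theorem insertRow_pairwise {m : ℕ} (p : Fin m) {R : List (Fin m)} (h : R.Pairwise (· ≤ ·)) :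
    (insertRow p R).1.Pairwise (· ≤ ·) := by
  induction R with
  | nil => simp [insertRow]
  | cons r R ih =>
    rw [List.pairwise_cons] at h
    unfold insertRow
    split_ifs with hp
    · exact List.pairwise_cons.2 ⟨fun y hy => hp.le.trans (h.1 y hy), h.2⟩
    · refine List.pairwise_cons.2 ⟨fun y hy => ?_, ih h.2⟩
      rcases mem_or_eq_of_mem_insertRow hy with rfl | hy
      · exact not_lt.1 hp
      · exact h.1 y hy

/-- Inserting successively `p ≤ p'`, the labels that are bumped are weakly increasing. -/
theorem insertRow_insertRow_snd {m : ℕ} {p p' x : Fin m} (hp : p ≤ p') {R : List (Fin m)}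
    (hR : R.Pairwise (· ≤ ·)) (h : (insertRow p' (insertRow p R).1).2 = some x) :
    ∃ y, (insertRow p R).2 = some y ∧ y ≤ x := by
  induction R with
  | nil => simp [insertRow, not_lt.2 hp] at h
  | cons r R ih =>
    rw [List.pairwise_cons] at hR
    by_cases h1 : p < r
    · simp only [insertRow, h1, if_true, not_lt.2 hp, if_false] at h ⊢
      exact ⟨r, rfl, hR.1 _ (mem_of_insertRow_snd_eq_some h)⟩
    · have h2 : ¬ p' < r := fun h2 => h1 (hp.trans_lt h2)
      simp only [insertRow, h1, h2, if_false] at h ⊢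
      exact ih hR.2 h

theorem insertRow_injective {m : ℕ} {p p' x : Fin m} {R R' : List (Fin m)}
    (hR : R.Pairwise (· ≤ ·)) (hR' : R'.Pairwise (· ≤ ·)) (h : (insertRow p R).2 = some x)
    (h' : (insertRow p' R').2 = some x) (heq : (insertRow p R).1 = (insertRow p' R').1) :
    p = p' ∧ R = R' := by
  have aux : ∀ {p p' r : Fin m} {R R' : List (Fin m)}, (r :: R).Pairwise (· ≤ ·) →
      (insertRow p' R').2 = some r → R = (insertRow p' R').1 → False := by
    intro p p' r R R' hR h' heq
    have h1 := lt_of_insertRow_snd_eq_some h'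
    have h2 : r ≤ p' := (List.pairwise_cons.1 hR).1 _ (heq ▸ mem_insertRow_self p' R')
    exact absurd h1 (not_lt.2 h2)
  induction R generalizing R' with
  | nil => simp [insertRow] at h
  | cons r R ih =>
    cases R' with
    | nil => simp [insertRow] at h'
    | cons r' R' =>
      by_cases h1 : p < r <;> by_cases h2 : p' < r' <;>
        simp only [insertRow, h1, h2, if_true, if_false, List.cons.injEq, Option.some.injEq]
          at h h' heq
      · exact ⟨heq.1, by rw [heq.2, h, h']⟩
      · subst h
        exact (aux (p := p) hR h' heq.2).elim
      · subst h'
        exact (aux (p := p) hR' h heq.2.symm).elim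
      · obtain ⟨h3, h4⟩ := ih (List.pairwise_cons.1 hR).2 (List.pairwise_cons.1 hR').2 h h' heq.2
        exact ⟨h3, by rw [heq.1, h4]⟩

/-! ### Tableaux -/

/-- The row `S` may stand below the row `R`: it is not longer, and every label of `S` is greater
than the label of `R` above it. -/
def ColStrict {m : ℕ} (R S : List (Fin m)) : Prop :=
  ∀ (c : ℕ) (y : Fin m), S[c]? = some y → ∃ x, R[c]? = some x ∧ x < y

@[simp] theorem colStrict_nil {m : ℕ} (R : List (Fin m)) : ColStrict R [] := by
  intro c y h
  simp at h

@[simp] theorem colStrict_cons {m : ℕ} (x y : Fin m) (R S : List (Fin m)) :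
    ColStrict (x :: R) (y :: S) ↔ x < y ∧ ColStrict R S := by
  constructor
  · intro h
    exact ⟨by simpa using h 0 y rfl, fun c z hz => by simpa using h (c + 1) z (by simpa using hz)⟩
  · rintro ⟨h1, h2⟩ c z hz
    cases c with
    | zero =>
      obtain rfl : y = z := by simpa using hz
      exact ⟨x, rfl, h1⟩
    | succ c => simpa using h2 c z (by simpa using hz)

@[simp] theorem not_colStrict_nil_cons {m : ℕ} (y : Fin m) (S : List (Fin m)) :
    ¬ ColStrict [] (y :: S) := by
  intro h
  simpa using h 0 y rfl

theorem ColStrict.length_le {m : ℕ} {R S : List (Fin m)} (h : ColStrict R S) :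
    S.length ≤ R.length := by
  by_contra hlt
  obtain ⟨x, hx, -⟩ := h R.length S[R.length] (List.getElem?_eq_getElem (by omega))
  simp at hx

theorem ColStrict.insertRow_left {m : ℕ} (p : Fin m) {R S : List (Fin m)} (h : ColStrict R S) :
    ColStrict (insertRow p R).1 S := by
  induction R generalizing S with
  | nil =>
    cases S with
    | nil => simp
    | cons => simp at h
  | cons r R ih =>
    cases S with
    | nil => simp
    | cons s S =>
      rw [colStrict_cons] at h
      unfold insertRow
      split_ifs with hp
      · exact (colStrict_cons ..).2 ⟨hp.trans h.1, h.2⟩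
      · exact (colStrict_cons ..).2 ⟨h.1, ih h.2⟩

/-- The label bumped from the row `R` is inserted in the next row `S`. -/
theorem ColStrict.insertRow_insertRow {m : ℕ} {p x : Fin m} {R S : List (Fin m)}
    (h : ColStrict R S) (hx : (insertRow p R).2 = some x) :
    ColStrict (insertRow p R).1 (insertRow x S).1 := by
  induction R generalizing S with
  | nil => simp [insertRow] at hx
  | cons r R ih =>
    by_cases hp : p < r
    · simp only [insertRow, hp, if_true, Option.some.injEq] at hx ⊢
      subst hx
      cases S with
      | nil => simp [insertRow, hp]
      | cons s S =>
        rw [colStrict_cons] at h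
        simp [insertRow, h.1, hp, h.2]
    · simp only [insertRow, hp, if_false] at hx ⊢
      have hrx : r < x := (not_lt.1 hp).trans_lt (lt_of_insertRow_snd_eq_some hx)
      cases S with
      | nil => simp [insertRow, hrx]
      | cons s S =>
        rw [colStrict_cons] at h
        by_cases hs : x < s
        · simp [insertRow, hs, hrx, h.2.insertRow_left p]
        · simp [insertRow, hs, h.1, ih h.2 hx]

/-- Semistandard tableaux, given by their nonempty rows. -/
def IsTableau {m : ℕ} : List (List (Fin m)) → Prop
  | [] => True
  | R :: T => R ≠ [] ∧ R.Pairwise (· ≤ ·) ∧ (∀ S ∈ T.head?, ColStrict R S) ∧ IsTableau T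

theorem insertTableau_cons_of_none {m : ℕ} {p : Fin m} {R : List (Fin m)}
    (T : List (List (Fin m))) (h : (insertRow p R).2 = none) :
    insertTableau p (R :: T) = ((R ++ [p]) :: T, 0) := by
  rw [insertTableau, insertRow_of_forall_le (forall_le_of_insertRow_snd_eq_none h)]

theorem insertTableau_cons_of_some {m : ℕ} {p x : Fin m} {R : List (Fin m)}
    (T : List (List (Fin m))) (h : (insertRow p R).2 = some x) :
    insertTableau p (R :: T)
      = ((insertRow p R).1 :: (insertTableau x T).1, (insertTableau x T).2 + 1) := by
  rw [insertTableau]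
  split
  · next h' => simp [h'] at h
  · next R' y h' =>
    rw [h'] at h
    obtain rfl : y = x := by simpa using h
    rw [h']

theorem insertTableau_nil {m : ℕ} (p : Fin m) : insertTableau p [] = ([[p]], 0) := rfl

theorem insertTableau_head {m : ℕ} (p : Fin m) (T : List (List (Fin m))) :
    (insertTableau p T).1.head? = some (insertRow p (T.head?.getD [])).1 := by
  cases T with
  | nil => rfl
  | cons R T =>
    cases h : (insertRow p R).2 with
    | none => simp [insertTableau_cons_of_none T h, insertRow_fst_of_snd_eq_none h]
    | some x => simp [insertTableau_cons_of_some T h]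

theorem IsTableau.insertTableau {m : ℕ} (p : Fin m) {T : List (List (Fin m))} (hT : IsTableau T) :
    IsTableau (insertTableau p T).1 := by
  induction T generalizing p with
  | nil => simp [RSKOp.insertTableau, IsTableau]
  | cons R T ih =>
    obtain ⟨h1, h2, h3, h4⟩ := hT
    cases h : (insertRow p R).2 with
    | none =>
      rw [insertTableau_cons_of_none T h, ← insertRow_fst_of_snd_eq_none h]
      exact ⟨insertRow_ne_nil _ _, insertRow_pairwise p h2, fun S hS => (h3 S hS).insertRow_left p,
        h4⟩
    | some x =>
      rw [insertTableau_cons_of_some T h]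
      refine ⟨insertRow_ne_nil _ _, insertRow_pairwise p h2, fun S hS => ?_, ih x h4⟩
      rw [insertTableau_head, Option.mem_some_iff] at hS
      subst hS
      refine ColStrict.insertRow_insertRow ?_ h
      cases hT : T.head? with
      | none => simp
      | some S => exact h3 S hT

/-- Row bumping lemma: inserting successively `p ≤ p'`, the second new box is weakly above the
first one. -/
theorem insertTableau_insertTableau_snd_le {m : ℕ} {p p' : Fin m} (hp : p ≤ p')
    {T : List (List (Fin m))} (hT : IsTableau T) :
    (insertTableau p' (insertTableau p T).1).2 ≤ (insertTableau p T).2 := by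
  induction T generalizing p p' with
  | nil =>
    have : (insertRow p' [p]).2 = none := by simp [insertRow, not_lt.2 hp]
    simp [insertTableau, insertTableau_cons_of_none [] this]
  | cons R T ih =>
    obtain ⟨h1, h2, h3, h4⟩ := hT
    cases h' : (insertRow p' (insertRow p R).1).2 with
    | none =>
      cases h : (insertRow p R).2 with
      | none =>
        rw [insertRow_fst_of_snd_eq_none h] at h'
        simp [insertTableau_cons_of_none T h, insertTableau_cons_of_none T h']
      | some x =>
        simp [insertTableau_cons_of_some T h, insertTableau_cons_of_none _ h']
    | some x' =>
      obtain ⟨x, hx, hxx⟩ := insertRow_insertRow_snd hp h2 h'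
      simp only [insertTableau_cons_of_some T hx, insertTableau_cons_of_some _ h',
        add_le_add_iff_right]
      exact ih hxx h4

theorem insertTableau_injective {m : ℕ} {p p' : Fin m} {T T' : List (List (Fin m))}
    (hT : IsTableau T) (hT' : IsTableau T') (h : insertTableau p T = insertTableau p' T') :
    p = p' ∧ T = T' := by
  induction T generalizing T' p p' with
  | nil =>
    cases T' with
    | nil => simpa [insertTableau] using h
    | cons R' T' =>
      cases h' : (insertRow p' R').2 with
      | none =>
        rw [insertTableau_cons_of_none T' h', insertTableau_nil] at h
        have : R' ++ [p'] = [p] := by simp_all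
        exact absurd (by simpa [List.append_eq_singleton_iff] using this : R' = [] ∧ _).1 hT'.1
      | some x => simp [insertTableau_cons_of_some T' h', insertTableau_nil] at h
  | cons R T ih =>
    cases T' with
    | nil =>
      cases h' : (insertRow p R).2 with
      | none =>
        rw [insertTableau_cons_of_none T h', insertTableau_nil] at h
        have : R ++ [p] = [p'] := by simp_all
        exact absurd (by simpa [List.append_eq_singleton_iff] using this : R = [] ∧ _).1 hT.1
      | some x => simp [insertTableau_cons_of_some T h', insertTableau_nil] at h
    | cons R' T' =>
      cases h1 : (insertRow p R).2 with
      | none =>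
        cases h2 : (insertRow p' R').2 with
        | none =>
          simp only [insertTableau_cons_of_none T h1, insertTableau_cons_of_none T' h2,
            Prod.mk.injEq, List.cons.injEq, and_true] at h
          obtain ⟨h3, h4⟩ := List.append_inj' h.1 rfl
          exact ⟨by simpa using h4, by rw [h3, h.2]⟩
        | some x' =>
          simp [insertTableau_cons_of_none T h1, insertTableau_cons_of_some T' h2] at h
      | some x =>
        cases h2 : (insertRow p' R').2 with
        | none =>
          simp [insertTableau_cons_of_some T h1, insertTableau_cons_of_none T' h2] at h
        | some x' =>
          simp only [insertTableau_cons_of_some T h1, insertTableau_cons_of_some T' h2,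
            Prod.mk.injEq, List.cons.injEq, add_left_inj] at h
          obtain ⟨rfl, rfl⟩ := ih hT.2.2.2 hT'.2.2.2 (Prod.ext h.1.2 h.2)
          obtain ⟨rfl, rfl⟩ := insertRow_injective hT.2.1 hT'.2.1 h1 h2 h.1.1
          exact ⟨rfl, rfl⟩

/-! ### The recording tableau -/

theorem addBox_injective {n : ℕ} {q : Fin n} {k : ℕ} {S S' : List (List (Fin n))}
    (hS : IsTableau S) (hS' : IsTableau S') (h : addBox q k S = addBox q k S') : S = S' := by
  have ne : ∀ (k : ℕ) (S : List (List (Fin n))), addBox q k S ≠ [] := by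
    intro k S
    cases S <;> cases k <;> simp [addBox]
  induction S generalizing S' k with
  | nil =>
    cases S' with
    | nil => rfl
    | cons R' S' =>
      have := hS'.1
      cases k with
      | zero =>
        simp only [addBox, List.cons.injEq] at h
        exact absurd (by simpa using h.1.symm) this
      | succ k => simp [addBox, (ne k S').symm] at h
  | cons R S ih =>
    cases S' with
    | nil =>
      have := hS.1
      cases k with
      | zero =>
        simp only [addBox, List.cons.injEq] at h
        exact absurd (by simpa using h.1) this
      | succ k => simp [addBox, ne k S] at h
    | cons R' S' =>
      cases k with
      | zero => simpa [addBox] using h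
      | succ k =>
        simp only [addBox, List.cons.injEq] at h
        rw [h.1, ih hS.2.2.2 hS'.2.2.2 h.2]

theorem addBox_getElem?_of_lt {n : ℕ} (q : Fin n) {k a : ℕ} {S : List (List (Fin n))}
    (hk : k ≤ S.length) (ha : a < k) : (addBox q k S)[a]? = S[a]? := by
  induction S generalizing k a with
  | nil => simp at hk; omega
  | cons R S ih =>
    cases k with
    | zero => omega
    | succ k =>
      cases a with
      | zero => simp [addBox]
      | succ a => simpa [addBox] using ih (by simpa using hk) (by omega)

theorem addBox_getElem?_self {n : ℕ} (q : Fin n) {k : ℕ} {S : List (List (Fin n))}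
    (hk : k ≤ S.length) : ∃ R, (addBox q k S)[k]? = some R ∧ q ∈ R := by
  induction S generalizing k with
  | nil =>
    obtain rfl : k = 0 := by simpa using hk
    exact ⟨[q], by simp [addBox], by simp⟩
  | cons R S ih =>
    cases k with
    | zero => exact ⟨R ++ [q], by simp [addBox], by simp⟩
    | succ k => simpa [addBox] using ih (by simpa using hk)

theorem insertTableau_snd_le_length {m : ℕ} (p : Fin m) (T : List (List (Fin m))) :
    (insertTableau p T).2 ≤ T.length := by
  induction T generalizing p with
  | nil => simp [insertTableau]
  | cons R T ih =>
    cases h : (insertRow p R).2 with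
    | none => simp [insertTableau_cons_of_none T h]
    | some x => simpa [insertTableau_cons_of_some T h] using ih x

theorem IsTableau.pairwise_length {m : ℕ} {T : List (List (Fin m))} (hT : IsTableau T) :
    (T.map List.length).IsChain (· ≥ ·) := by
  induction T with
  | nil => simp
  | cons R T ih =>
    obtain ⟨-, -, h3, h4⟩ := hT
    cases T with
    | nil => simp
    | cons S T => exact List.IsChain.cons_cons (h3 S rfl).length_le (ih h4)

theorem colStrict_append {n : ℕ} {q : Fin n} {R S : List (Fin n)} (hRS : ColStrict R S)
    (hlen : S.length + 1 ≤ R.length) (hR : ∀ x ∈ R, x < q) : ColStrict R (S ++ [q]) := by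
  intro c y hy
  rcases lt_trichotomy c S.length with hc | rfl | hc
  · rw [List.getElem?_append_left hc] at hy
    exact hRS c y hy
  · obtain rfl : q = y := by simpa using hy
    exact ⟨R[S.length], List.getElem?_eq_getElem _, hR _ (List.getElem_mem _)⟩
  · rw [List.getElem?_eq_none (by simp; omega)] at hy
    simp at hy

theorem IsTableau.addBox {n : ℕ} {q : Fin n} {k : ℕ} {S : List (List (Fin n))} (hS : IsTableau S)
    (hshape : ((addBox q k S).map List.length).IsChain (· ≥ ·)) (hle : ∀ x ∈ S.flatten, x ≤ q)
    (hk : ∀ a < k, ∀ R, S[a]? = some R → q ∉ R) : IsTableau (addBox q k S) := by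
  induction S generalizing k with
  | nil => cases k <;> simp [RSKOp.addBox, IsTableau]
  | cons R S ih =>
    obtain ⟨h1, h2, h3, h4⟩ := hS
    simp only [List.flatten_cons, List.mem_append] at hle
    cases k with
    | zero =>
      refine ⟨by simp, ?_, fun S' hS' c y hy => ?_, h4⟩
      · rw [List.pairwise_append]
        exact ⟨h2, by simp, fun x hx y hy => by simpa [List.mem_singleton.1 hy] using hle x (.inl hx)⟩
      · obtain ⟨x, hx, hxy⟩ := h3 S' hS' c y hy
        refine ⟨x, ?_, hxy⟩
        rw [List.getElem?_append_left (List.getElem?_eq_some_iff.1 hx).1, hx]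
    | succ k =>
      simp only [RSKOp.addBox, List.map_cons] at hshape
      have hR : ∀ x ∈ R, x < q := fun x hx => lt_of_le_of_ne (hle x (.inl hx))
        (fun h => hk 0 (by omega) R rfl (h ▸ hx))
      refine ⟨h1, h2, fun S' hS' => ?_, ih h4 hshape.tail (fun x hx => hle x (.inr hx))
        fun a ha R' hR' => hk (a + 1) (by omega) R' (by simpa using hR')⟩
      cases S with
      | nil =>
        obtain rfl : S' = [q] := by cases k <;> simpa [RSKOp.addBox, eq_comm] using hS'
        obtain ⟨r, R, rfl⟩ := List.exists_cons_of_ne_nil h1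
        simp [hR r (by simp)]
      | cons S₁ S =>
        have h5 := h3 S₁ rfl
        cases k with
        | zero =>
          obtain rfl : S₁ ++ [q] = S' := by simpa [RSKOp.addBox] using hS'
          refine colStrict_append h5 ?_ hR
          simpa [RSKOp.addBox] using hshape.rel
        | succ k =>
          obtain rfl : S₁ = S' := by simpa [RSKOp.addBox] using hS'
          exact h5

/-! ### The correspondence on sorted biwords -/

/-- The order in which the biletters occur in the biword of a matrix. -/
def BiletterLE {m n : ℕ} (b b' : Fin m × Fin n) : Prop :=
  b.2 < b'.2 ∨ b.2 = b'.2 ∧ b.1 ≤ b'.1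

theorem BiletterLE.snd_le {m n : ℕ} {b b' : Fin m × Fin n} (h : BiletterLE b b') : b.2 ≤ b'.2 :=
  h.elim le_of_lt fun h => h.1.le

theorem foldl_insertBiletter_snd_perm {m n : ℕ} (w : List (Fin m × Fin n)) :
    (w.foldl insertBiletter ([], [])).2.flatten.Perm (w.map Prod.snd) := by
  simpa using (foldl_insert w ([], []) rfl).2.2

theorem foldl_insertBiletter_shape {m n : ℕ} (w : List (Fin m × Fin n)) :
    (w.foldl insertBiletter ([], [])).1.map List.length
      = (w.foldl insertBiletter ([], [])).2.map List.length :=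
  (foldl_insert w ([], []) rfl).1

theorem foldl_insertBiletter_fst_isTableau {m n : ℕ} (w : List (Fin m × Fin n)) :
    IsTableau (w.foldl insertBiletter ([], [])).1 := by
  induction w using List.reverseRecOn with
  | nil => trivial
  | append_singleton w b ih =>
    rw [List.foldl_append]
    exact ih.insertTableau b.1

/-- The new box is weakly above all the boxes with the same label in the recording tableau. -/
theorem notMem_of_lt_insertTableau_snd {m n : ℕ} {w : List (Fin m × Fin n)} {b : Fin m × Fin n}
    (h : (w ++ [b]).Pairwise BiletterLE) {a : ℕ}
    (ha : a < (insertTableau b.1 (w.foldl insertBiletter ([], [])).1).2) {R : List (Fin n)}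
    (hR : (w.foldl insertBiletter ([], [])).2[a]? = some R) : b.2 ∉ R := by
  induction w using List.reverseRecOn generalizing b R with
  | nil => simp at hR
  | append_singleton w b' ih =>
    intro hb
    have hmem : b.2 ∈ (w ++ [b']).map Prod.snd := (foldl_insertBiletter_snd_perm _).subset
      (List.mem_flatten.2 ⟨R, List.mem_of_getElem? hR, hb⟩)
    rw [List.pairwise_append] at h
    obtain ⟨c, hc, hcb⟩ := List.mem_map.1 hmem
    have hcb' : b.2 ≤ b'.2 := by
      rw [← hcb]
      rcases List.mem_append.1 hc with hc | hc
      · exact ((List.pairwise_append.1 h.1).2.2 c hc b' (by simp)).snd_le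
      · rw [List.mem_singleton.1 hc]
    have hlt : b'.2 = b.2 ∧ b'.1 ≤ b.1 :=
      (h.2.2 b' (by simp) b (by simp)).resolve_left (not_lt.2 hcb')
    set PQ := w.foldl insertBiletter ([], []) with hPQ
    have hfold : (w ++ [b']).foldl insertBiletter ([], []) = insertBiletter PQ b' := by
      rw [List.foldl_append]
      rfl
    rw [hfold] at ha hR
    have hbump := insertTableau_insertTableau_snd_le hlt.2
      (hPQ ▸ foldl_insertBiletter_fst_isTableau w)
    have hlen : PQ.1.length = PQ.2.length := by
      simpa using congrArg List.length (foldl_insertBiletter_shape w)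
    have ha' : a < (insertTableau b'.1 PQ.1).2 := lt_of_lt_of_le ha hbump
    have hR' : PQ.2[a]? = some R := by
      rw [← hR]
      exact (addBox_getElem?_of_lt _ (hlen ▸ insertTableau_snd_le_length _ _) ha').symm
    exact ih h.1 ha' hR' (hlt.1 ▸ hb)

theorem mem_snd_le_of_pairwise {m n : ℕ} {w : List (Fin m × Fin n)} {b : Fin m × Fin n}
    (h : (w ++ [b]).Pairwise BiletterLE) {x : Fin n} (hx : x ∈ w.map Prod.snd) : x ≤ b.2 := by
  obtain ⟨c, hc, rfl⟩ := List.mem_map.1 hx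
  exact ((List.pairwise_append.1 h).2.2 c hc b (by simp)).snd_le

theorem foldl_insertBiletter_snd_isTableau {m n : ℕ} {w : List (Fin m × Fin n)}
    (h : w.Pairwise BiletterLE) : IsTableau (w.foldl insertBiletter ([], [])).2 := by
  induction w using List.reverseRecOn with
  | nil => trivial
  | append_singleton w b ih =>
    have hP := (foldl_insertBiletter_fst_isTableau (w ++ [b])).pairwise_length
    rw [foldl_insertBiletter_shape] at hP
    rw [List.foldl_append] at hP ⊢
    exact (ih (List.pairwise_append.1 h).1).addBox hP
      (fun x hx => mem_snd_le_of_pairwise h ((foldl_insertBiletter_snd_perm w).subset hx))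
      fun a ha R hR => notMem_of_lt_insertTableau_snd h ha hR

theorem foldl_insertBiletter_injective {m n : ℕ} {w w' : List (Fin m × Fin n)}
    (h : w.Pairwise BiletterLE) (h' : w'.Pairwise BiletterLE)
    (heq : w.foldl insertBiletter ([], []) = w'.foldl insertBiletter ([], [])) : w = w' := by
  induction w using List.reverseRecOn generalizing w' with
  | nil =>
    have := (foldl_insertBiletter_snd_perm w').length_eq
    rw [← heq] at this
    simpa [eq_comm] using this
  | append_singleton w b ih =>
    cases w' using List.reverseRecOn with
    | nil =>
      have := (foldl_insertBiletter_snd_perm (w ++ [b])).length_eq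
      rw [heq] at this
      simp at this
    | append_singleton w' b' =>
      have hq : b.2 = b'.2 := by
        have hperm : ((w ++ [b]).map Prod.snd).Perm ((w' ++ [b']).map Prod.snd) :=
          (foldl_insertBiletter_snd_perm _).symm.trans (heq ▸ foldl_insertBiletter_snd_perm _)
        have key : ∀ {v v' : List (Fin m × Fin n)} {c c' : Fin m × Fin n},
            (v' ++ [c']).Pairwise BiletterLE →
            ((v ++ [c]).map Prod.snd).Perm ((v' ++ [c']).map Prod.snd) → c.2 ≤ c'.2 := by
          intro v v' c c' hv hp
          have : c.2 ∈ (v' ++ [c']).map Prod.snd := hp.subset (by simp)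
          rw [List.map_append, List.mem_append] at this
          rcases this with hc | hc
          · exact mem_snd_le_of_pairwise hv hc
          · exact (by simpa using hc : c.2 = c'.2).le
        exact le_antisymm (key h' hperm) (key h hperm.symm)
      have hlen : ∀ v : List (Fin m × Fin n), (v.foldl insertBiletter ([], [])).1.length
          = (v.foldl insertBiletter ([], [])).2.length := fun v => by
        simpa using congrArg List.length (foldl_insertBiletter_shape v)
      simp only [List.foldl_append, List.foldl_cons, List.foldl_nil, insertBiletter,
        Prod.mk.injEq] at heq
      have hk : ∀ {v v' : List (Fin m × Fin n)} {c c' : Fin m × Fin n},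
          (v' ++ [c']).Pairwise BiletterLE → c.2 = c'.2 →
          addBox c.2 (insertTableau c.1 (v.foldl insertBiletter ([], [])).1).2
            (v.foldl insertBiletter ([], [])).2 =
          addBox c'.2 (insertTableau c'.1 (v'.foldl insertBiletter ([], [])).1).2
            (v'.foldl insertBiletter ([], [])).2 →
          ¬ (insertTableau c.1 (v.foldl insertBiletter ([], [])).1).2
            < (insertTableau c'.1 (v'.foldl insertBiletter ([], [])).1).2 := by
        intro v v' c c' hv hc hbox hlt
        obtain ⟨R, hR, hcR⟩ := addBox_getElem?_self c.2
          (hlen v ▸ insertTableau_snd_le_length c.1 _)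
        rw [hbox, addBox_getElem?_of_lt _ (hlen v' ▸ insertTableau_snd_le_length c'.1 _) hlt] at hR
        exact notMem_of_lt_insertTableau_snd hv hlt hR (hc ▸ hcR)
      have hkk := le_antisymm (not_lt.1 (hk h hq.symm heq.2.symm)) (not_lt.1 (hk h' hq heq.2))
      have hw := (List.pairwise_append.1 h).1
      have hw' := (List.pairwise_append.1 h').1
      obtain ⟨hp, hP⟩ := insertTableau_injective (foldl_insertBiletter_fst_isTableau w)
        (foldl_insertBiletter_fst_isTableau w') (Prod.ext heq.1 hkk)
      have hQ := heq.2
      rw [hq, hkk] at hQ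
      have hQ' := addBox_injective (foldl_insertBiletter_snd_isTableau hw)
        (foldl_insertBiletter_snd_isTableau hw') hQ
      rw [ih hw hw' (Prod.ext hP hQ'), Prod.ext hp hq]

/-! ### Biwords of matrices -/

theorem biword_pairwise {m n : ℕ} (α : ExpMat m n) : (biword α).Pairwise BiletterLE := by
  unfold biword
  rw [List.pairwise_flatMap]
  refine ⟨fun j _ => ?_, (List.pairwise_lt_finRange n).imp fun {j j'} hjj' x hx y hy => ?_⟩
  · rw [List.pairwise_flatMap]
    refine ⟨fun i _ => ?_, (List.pairwise_lt_finRange m).imp fun {i i'} hii' x hx y hy => ?_⟩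
    · exact List.pairwise_replicate.2 (.inr (.inr ⟨rfl, le_rfl⟩))
    · rw [List.eq_of_mem_replicate hx, List.eq_of_mem_replicate hy]
      exact .inr ⟨rfl, hii'.le⟩
  · simp only [List.mem_flatMap, List.mem_finRange, true_and] at hx hy
    obtain ⟨i, hx⟩ := hx
    obtain ⟨i', hy⟩ := hy
    rw [List.eq_of_mem_replicate hx, List.eq_of_mem_replicate hy]
    exact .inl hjj'

theorem count_biword {m n : ℕ} (α : ExpMat m n) (b : Fin m × Fin n) :
    (biword α).count b = α b := by
  obtain ⟨i, j⟩ := b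
  simp only [biword, List.count_flatMap, List.count_replicate, Function.comp_def, beq_iff_eq,
    Prod.mk.injEq]
  rw [← List.ofFn_eq_map, List.sum_ofFn, Finset.sum_eq_single j]
  · rw [← List.ofFn_eq_map, List.sum_ofFn, Finset.sum_eq_single i]
    · simp
    · intro k _ hk
      simp [hk]
    · simp
  · intro b _ hb
    rw [← List.ofFn_eq_map, List.sum_ofFn]
    simp [hb]
  · simp

theorem biword_injective {m n : ℕ} : Function.Injective (biword (m := m) (n := n)) := by
  intro α β h
  ext b
  rw [← count_biword, h, count_biword]

theorem rsk_injective {m n : ℕ} : Function.Injective (rsk (m := m) (n := n)) := fun α β h =>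
  biword_injective (foldl_insertBiletter_injective (biword_pairwise α) (biword_pairwise β) h)

/-! ### Columns and row contents of tableaux -/

theorem IsTableau.getElem?_eq_none {m : ℕ} {T : List (List (Fin m))} (hT : IsTableau T) {c : ℕ}
    (h : ∀ R ∈ T.head?, R[c]? = none) : ∀ R ∈ T, R[c]? = none := by
  induction T with
  | nil => simp
  | cons R T ih =>
    obtain ⟨-, -, h3, h4⟩ := hT
    have hR := h R rfl
    refine List.forall_mem_cons.2 ⟨hR, ih h4 fun S hS => ?_⟩
    cases hS' : S[c]? with
    | none => rfl
    | some y =>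
      obtain ⟨x, hx, -⟩ := h3 S hS c y hS'
      rw [hR] at hx
      cases hx

theorem IsTableau.column_getElem? {m : ℕ} {T : List (List (Fin m))} (hT : IsTableau T) (c a : ℕ) :
    (column T c)[a]? = T[a]?.bind (·[c]?) := by
  induction T generalizing a with
  | nil => simp [column]
  | cons R T ih =>
    cases hR : R[c]? with
    | none =>
      have hall := hT.getElem?_eq_none (c := c) (by simpa using hR)
      have hcol : column (R :: T) c = [] := List.filterMap_eq_nil_iff.2 hall
      rw [hcol]
      cases h : (R :: T)[a]? with
      | none => simp
      | some S => simp [hall S (List.mem_of_getElem? h)]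
    | some x =>
      have hcol : column (R :: T) c = x :: column T c := by simp [column, hR]
      rw [hcol]
      cases a with
      | zero => simp [hR]
      | succ a => simpa using ih hT.2.2.2 a

theorem IsTableau.column_pairwise {m : ℕ} {T : List (List (Fin m))} (hT : IsTableau T) (c : ℕ) :
    (column T c).Pairwise (· < ·) := by
  rw [← List.isChain_iff_pairwise]
  induction T with
  | nil => simp [column]
  | cons R T ih =>
    cases hR : R[c]? with
    | none => simpa [column, hR] using ih hT.2.2.2
    | some x =>
      have hcol : column (R :: T) c = x :: column T c := by simp [column, hR]
      rw [hcol, List.isChain_cons]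
      refine ⟨fun y hy => ?_, ih hT.2.2.2⟩
      rw [List.head?_eq_getElem?, hT.2.2.2.column_getElem?] at hy
      obtain ⟨S, hS, hSy⟩ := Option.bind_eq_some_iff.1 hy
      obtain ⟨z, hz, hzy⟩ := hT.2.2.1 S (by rw [List.head?_eq_getElem?]; exact hS) c y hSy
      rw [hR] at hz
      exact (Option.some.inj hz) ▸ hzy

theorem length_column_eq {m n : ℕ} {P : List (List (Fin m))} {Q : List (List (Fin n))}
    (h : P.map List.length = Q.map List.length) (c : ℕ) :
    (column P c).length = (column Q c).length := by
  induction P generalizing Q with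
  | nil =>
    obtain rfl : Q = [] := by simpa [eq_comm] using h
    rfl
  | cons R P ih =>
    cases Q with
    | nil => simp at h
    | cons S Q =>
      simp only [List.map_cons, List.cons.injEq] at h
      have := ih h.2
      by_cases hc : c < R.length
      · have hc' : c < S.length := h.1 ▸ hc
        simpa [column, List.getElem?_eq_getElem hc, List.getElem?_eq_getElem hc'] using this
      · have hc' : ¬ c < S.length := h.1 ▸ hc
        simpa [column, List.getElem?_eq_none (not_lt.1 hc), List.getElem?_eq_none (not_lt.1 hc')]
          using this

theorem sum_ite_getElem? {m : ℕ} (R : List (Fin m)) (i : Fin m) {N : ℕ} (hN : R.length ≤ N) :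
    ∑ c ∈ Finset.range N, (if R[c]? = some i then 1 else 0) = R.count i := by
  have h := count_column [R] i N (by simpa [width] using hN)
  simp only [List.flatten_cons, List.flatten_nil, List.append_nil] at h
  rw [← h]
  refine Finset.sum_congr rfl fun c _ => ?_
  cases hc : R[c]? with
  | none => simp [column, hc]
  | some x => simp [column, hc, List.count_cons]

theorem length_le_width {m : ℕ} {T : List (List (Fin m))} {R : List (Fin m)} (h : R ∈ T) :
    R.length ≤ width T := by
  induction T with
  | nil => simp at h
  | cons S T ih =>
    rcases List.mem_cons.1 h with rfl | h
    · simp [width]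
    · exact (ih h).trans (by simp [width])

theorem IsTableau.sum_ite_column {m : ℕ} {T : List (List (Fin m))} (hT : IsTableau T) (a : ℕ)
    (i : Fin m) :
    ∑ c ∈ Finset.range (width T), (if (column T c)[a]? = some i then 1 else 0)
      = (T[a]?.getD []).count i := by
  simp only [hT.column_getElem?]
  cases h : T[a]? with
  | none => simp
  | some R => simpa using sum_ite_getElem? R i (length_le_width (List.mem_of_getElem? h))

theorem IsTableau.length_le {m : ℕ} {T : List (List (Fin m))} (hT : IsTableau T) :
    T.length ≤ m := by
  have hcol : ∀ T : List (List (Fin m)), IsTableau T → (column T 0).length = T.length := by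
    intro T hT
    induction T with
    | nil => rfl
    | cons R T ih =>
      obtain ⟨x, R, rfl⟩ := List.exists_cons_of_ne_nil hT.1
      simpa [column] using ih hT.2.2.2
  have hnd : (column T 0).Nodup := (hT.column_pairwise 0).imp ne_of_lt
  have := List.Nodup.length_le_card hnd
  simpa [hcol T hT] using this

theorem IsTableau.mem {m : ℕ} {T : List (List (Fin m))} (hT : IsTableau T) {R : List (Fin m)}
    (hR : R ∈ T) : R ≠ [] ∧ R.Pairwise (· ≤ ·) := by
  induction T with
  | nil => simp at hR
  | cons S T ih =>
    rcases List.mem_cons.1 hR with rfl | hR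
    · exact ⟨hT.1, hT.2.1⟩
    · exact ih hT.2.2.2 hR

/-- A tableau is determined by the contents of its rows. -/
theorem IsTableau.eq_of_count {m : ℕ} {T T' : List (List (Fin m))} (hT : IsTableau T)
    (hT' : IsTableau T') (h : ∀ (a : ℕ) (i : Fin m), (T[a]?.getD []).count i = (T'[a]?.getD []).count i) :
    T = T' := by
  refine List.ext_getElem? fun a => ?_
  have hp : (T[a]?.getD []).Perm (T'[a]?.getD []) := List.perm_iff_count.2 (h a)
  cases h1 : T[a]? with
  | none =>
    cases h2 : T'[a]? with
    | none => rfl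
    | some R' =>
      rw [h1, h2] at hp
      exact absurd (by simpa using hp) (hT'.mem (List.mem_of_getElem? h2)).1
  | some R =>
    cases h2 : T'[a]? with
    | none =>
      rw [h1, h2] at hp
      exact absurd (by simpa using hp) (hT.mem (List.mem_of_getElem? h1)).1
    | some R' =>
      rw [h1, h2] at hp
      simp only [Option.getD_some] at hp
      rw [hp.eq_of_pairwise (fun _ _ _ _ => le_antisymm) (hT.mem (List.mem_of_getElem? h1)).2
        (hT'.mem (List.mem_of_getElem? h2)).2]

/-! ### Leading monomials -/

/-- A part of the Cauchy-Binet formula. -/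
theorem det_mul_eq_sum {k r : ℕ} {R : Type*} [CommRing R] (A : Matrix (Fin k) (Fin r) R)
    (B : Matrix (Fin r) (Fin k) R) :
    (A * B).det = ∑ t : (Fin k → Fin r) × Equiv.Perm (Fin k) with Function.Injective t.1,
      ((Equiv.Perm.sign t.2 : ℤ) : R) * ((∏ a, A (t.2 a) (t.1 a)) * ∏ a, B (t.1 a) a) := by
  classical
  have h1 : (A * B).det = ∑ w : Fin k → Fin r, (A.submatrix id w).det * ∏ a, B (w a) a := by
    simp only [Matrix.det_apply', Matrix.mul_apply, Finset.prod_univ_sum, Finset.mul_sum,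
      Fintype.piFinset_univ, Finset.sum_mul, Matrix.submatrix_apply, id_eq]
    rw [Finset.sum_comm]
    simp only [Finset.prod_mul_distrib, mul_assoc]
  rw [h1, Finset.sum_filter, Fintype.sum_prod_type]
  refine Finset.sum_congr rfl fun w _ => ?_
  by_cases hw : Function.Injective w
  · simp [hw, Matrix.det_apply', Finset.sum_mul, mul_assoc]
  · simp only [hw, if_false, Finset.sum_const_zero]
    simp only [Function.Injective, not_forall] at hw
    obtain ⟨a, b, hab, hne⟩ := hw
    rw [Matrix.det_zero_of_column_eq hne (fun i => by simp [hab]), zero_mul]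

open MonomialOrder in
theorem monic_and_degree_sum_monomial {V ι R : Type*} [CommRing R] [Nontrivial R]
    (ord : MonomialOrder V) (s : Finset ι) (E : ι → V →₀ ℕ) (c : ι → R) {t₀ : ι} (ht₀ : t₀ ∈ s)
    (hc : c t₀ = 1) (hlt : ∀ t ∈ s, t ≠ t₀ → E t ≺[ord] E t₀) :
    ord.Monic (∑ t ∈ s, MvPolynomial.monomial (E t) (c t)) ∧
      ord.degree (∑ t ∈ s, MvPolynomial.monomial (E t) (c t)) = E t₀ := by
  classical
  set f := ∑ t ∈ s, MvPolynomial.monomial (E t) (c t) with hf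
  have hcoeff : f.coeff (E t₀) = 1 := by
    rw [hf, MvPolynomial.coeff_sum, Finset.sum_eq_single t₀]
    · simp [hc]
    · intro t ht hne
      rw [MvPolynomial.coeff_monomial, if_neg]
      intro h
      exact (h ▸ hlt t ht hne).false
    · exact fun h => absurd ht₀ h
  have hdeg : ord.degree f = E t₀ := by
    apply ord.toSyn.injective
    apply le_antisymm
    · rw [MonomialOrder.degree_le_iff]
      intro e he
      rw [MvPolynomial.mem_support_iff, hf, MvPolynomial.coeff_sum] at he
      obtain ⟨t, ht, hne⟩ := Finset.exists_ne_zero_of_sum_ne_zero he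
      rw [MvPolynomial.coeff_monomial] at hne
      have hte : E t = e := by
        by_contra h
        simp [h] at hne
      by_cases h : t = t₀
      · rw [← hte, h]
      · exact hte ▸ (hlt t ht h).le
    · exact MonomialOrder.le_degree (by rw [MvPolynomial.mem_support_iff, hcoeff]; exact one_ne_zero)
  exact ⟨by rw [MonomialOrder.Monic, MonomialOrder.leadingCoeff, hdeg, hcoeff], hdeg⟩

/-- Among the monomials `∏ x (f a, g a)`, with `f` injective, the lexicographically largest one is
that of the diagonal. -/
theorem toLex_sum_single_lt {V : Type*} [LinearOrder V] {k r s : ℕ} (e : Fin r ×ₗ Fin s → V)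
    (he : StrictMono e) (hk : k ≤ r) {f : Fin k → Fin r} (hf : Function.Injective f)
    {g : Fin k → Fin s} (hg : StrictMono g) (hne : f ≠ Fin.castLE hk) :
    toLex (∑ a, Finsupp.single (e (toLex (f a, g a))) 1 : V →₀ ℕ)
      < toLex (∑ a, Finsupp.single (e (toLex (Fin.castLE hk a, g a))) 1) := by
  classical
  have hex : ∃ N, ∃ h : N < k, f ⟨N, h⟩ ≠ Fin.castLE hk ⟨N, h⟩ := by
    by_contra! h
    exact hne (funext fun a => h a a.2)
  obtain ⟨hN, hfN⟩ := Nat.find_spec hex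
  have hmin : ∀ b : Fin k, b.1 < Nat.find hex → f b = Fin.castLE hk b := by
    intro b hb
    by_contra h
    exact Nat.find_min hex hb ⟨b.2, h⟩
  generalize Nat.find hex = N at hN hfN hmin
  set a₀ : Fin k := ⟨N, hN⟩ with ha₀
  rw [Finsupp.Lex.lt_iff]
  refine ⟨e (toLex (Fin.castLE hk a₀, g a₀)), fun v hv => ?_, ?_⟩
  · simp only [ofLex_toLex, Finsupp.finsetSum_apply, Finsupp.single_apply]
    refine Finset.sum_congr rfl fun b _ => ?_
    by_cases hb : f b = Fin.castLE hk b
    · rw [hb]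
    · have hNb : N ≤ b.1 := not_lt.1 fun h => hb (hmin b h)
      rw [if_neg, if_neg]
      · rintro rfl
        rw [he.lt_iff_lt, Prod.Lex.toLex_lt_toLex] at hv
        rcases hv with hv | ⟨hv1, hv2⟩
        · have : b.1 < N := hv
          omega
        · have hba : b = a₀ := Fin.castLE_injective hk hv1
          exact hv2.ne (by rw [hba])
      · rintro rfl
        rw [he.lt_iff_lt, Prod.Lex.toLex_lt_toLex] at hv
        rcases hv with hv | ⟨hv1, hv2⟩
        · have hlt : (f b).1 < N := hv
          have h2 := hmin ⟨(f b).1, hlt.trans hN⟩ hlt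
          have h3 : (⟨(f b).1, hlt.trans hN⟩ : Fin k) = b := hf (by rw [h2]; rfl)
          have h4 : (f b).1 = b.1 := congrArg Fin.val h3
          omega
        · have := hg.lt_iff_lt.1 hv2
          have : b.1 < N := this
          omega
  · simp only [ofLex_toLex, Finsupp.finsetSum_apply]
    have hzero : ∑ b, (Finsupp.single (e (toLex (f b, g b))) 1 : V →₀ ℕ)
        (e (toLex (Fin.castLE hk a₀, g a₀))) = 0 := by
      refine Finset.sum_eq_zero fun b _ => ?_
      rw [Finsupp.single_apply, if_neg]
      intro h
      have h := he.injective h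
      simp only [EmbeddingLike.apply_eq_iff_eq, Prod.mk.injEq] at h
      rw [hg.injective h.2] at h
      exact hfN h.1
    rw [hzero]
    refine lt_of_lt_of_le Nat.zero_lt_one ?_
    refine le_trans ?_ (Finset.single_le_sum (fun _ _ => Nat.zero_le _) (Finset.mem_univ a₀))
    simp

theorem linearIndependent_of_degree_injective {V ι k : Type*} [Field k] (ord : MonomialOrder V)
    (f : ι → MvPolynomial V k) (hf : ∀ i, ord.Monic (f i))
    (hinj : Function.Injective fun i => ord.degree (f i)) : LinearIndependent k f := by
  classical
  rw [linearIndependent_iff']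
  intro s g hg
  by_contra! h
  obtain ⟨i₀, hi₀, hgi₀⟩ := h
  obtain ⟨i, hi, hmax⟩ := Finset.exists_max_image (s.filter fun i => g i ≠ 0)
    (fun i => ord.toSyn (ord.degree (f i))) ⟨i₀, Finset.mem_filter.2 ⟨hi₀, hgi₀⟩⟩
  rw [Finset.mem_filter] at hi
  have hc := congrArg (MvPolynomial.coeff (ord.degree (f i))) hg
  rw [MvPolynomial.coeff_sum, Finset.sum_eq_single i] at hc
  · rw [MvPolynomial.coeff_smul, (hf i).coeff_degree] at hc
    exact hi.2 (by simpa using hc)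
  · intro j hj hji
    rw [MvPolynomial.coeff_smul]
    by_cases hgj : g j = 0
    · simp [hgj]
    · rw [MonomialOrder.coeff_eq_zero_of_lt, smul_zero]
      refine lt_of_le_of_ne (hmax j (Finset.mem_filter.2 ⟨hj, hgj⟩)) fun h => hji ?_
      exact hinj (ord.toSyn.injective h)
  · exact fun h => absurd hi.1 h

/-! ### Bitableaux over an arbitrary ring, and their linear independence -/

/-- The minor of the generic matrix over an arbitrary commutative ring. -/
noncomputable def minorOver (R : Type*) [CommRing R] {m n : ℕ} (u : List (Fin m))
    (v : List (Fin n)) : MvPolynomial (Fin m × Fin n) R :=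
  if h : u.length = v.length then
    Matrix.det (Matrix.of fun a b : Fin u.length => MvPolynomial.X (u.get a, v.get (Fin.cast h b)))
  else 0

/-- The bitableau over an arbitrary commutative ring. -/
noncomputable def bitableauOver (R : Type*) [CommRing R] {m n : ℕ}
    (PQ : List (List (Fin m)) × List (List (Fin n))) : MvPolynomial (Fin m × Fin n) R :=
  ∏ c ∈ Finset.range (width PQ.1), minorOver R (column PQ.1 c) (column PQ.2 c)

theorem map_minorOver {R S : Type*} [CommRing R] [CommRing S] (f : R →+* S) {m n : ℕ}
    (u : List (Fin m)) (v : List (Fin n)) :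
    MvPolynomial.map f (minorOver R u v) = minorOver S u v := by
  unfold minorOver
  split_ifs with h
  · rw [RingHom.map_det]
    congr 1
    ext1 a b
    simp
  · simp

theorem map_bitableauOver {R S : Type*} [CommRing R] [CommRing S] (f : R →+* S) {m n : ℕ}
    (PQ : List (List (Fin m)) × List (List (Fin n))) :
    MvPolynomial.map f (bitableauOver R PQ) = bitableauOver S PQ := by
  simp [bitableauOver, map_prod, map_minorOver]

theorem bitableauOver_complex {m n : ℕ} (PQ : List (List (Fin m)) × List (List (Fin n))) :
    bitableauOver ℂ PQ = bitableau PQ := rfl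

/-- The variables of the two factors in the factorization of the generic matrix, ordered
lexicographically. -/
abbrev FactorVar (m n : ℕ) : Type := (Fin m ×ₗ Fin m) ⊕ₗ (Fin m ×ₗ Fin n)

/-- The entries of the first factor, indexed by column and row. -/
def rowVar {m n : ℕ} (x : Fin m ×ₗ Fin m) : FactorVar m n := toLex (Sum.inl x)

/-- The entries of the second factor, indexed by row and column. -/
def colVar {m n : ℕ} (x : Fin m ×ₗ Fin n) : FactorVar m n := toLex (Sum.inr x)

theorem rowVar_strictMono {m n : ℕ} : StrictMono (rowVar (m := m) (n := n)) := fun _ _ h =>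
  Sum.Lex.inl_lt_inl_iff.2 h

theorem colVar_strictMono {m n : ℕ} : StrictMono (colVar (m := m) (n := n)) := fun _ _ h =>
  Sum.Lex.inr_lt_inr_iff.2 h

theorem rowVar_ne_colVar {m n : ℕ} (x : Fin m ×ₗ Fin m) (y : Fin m ×ₗ Fin n) :
    rowVar x ≠ colVar y := by
  intro h
  have := toLex.injective h
  cases this

instance (m n : ℕ) : Finite (FactorVar m n) :=
  Finite.of_equiv ((Fin m × Fin m) ⊕ (Fin m × Fin n))
    ((Equiv.sumCongr toLex toLex).trans toLex)

/-- The lexicographic order on the monomials in the entries of the two factors. -/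
noncomputable def factorOrder (m n : ℕ) : MonomialOrder (FactorVar m n) :=
  MonomialOrder.lex

/-- The substitution of a product of two generic matrices for the generic matrix. -/
noncomputable def factorHom (R : Type*) [CommRing R] (m n : ℕ) :
    MvPolynomial (Fin m × Fin n) R →ₐ[R] MvPolynomial (FactorVar m n) R :=
  MvPolynomial.aeval fun p => ∑ a : Fin m,
    MvPolynomial.X (rowVar (toLex (a, p.1))) * MvPolynomial.X (colVar (toLex (a, p.2)))

theorem factorHom_det {R : Type*} [CommRing R] {m n k : ℕ} (u : Fin k → Fin m) (v : Fin k → Fin n) :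
    factorHom R m n (Matrix.det (Matrix.of fun a b => MvPolynomial.X (u a, v b)))
      = ∑ t : (Fin k → Fin m) × Equiv.Perm (Fin k) with Function.Injective t.1,
        MvPolynomial.monomial ((∑ a, Finsupp.single (rowVar (toLex (t.1 (t.2⁻¹ a), u a))) 1)
          + ∑ a, Finsupp.single (colVar (toLex (t.1 a, v a))) 1) ((Equiv.Perm.sign t.2 : ℤ) : R) := by
  have h : (factorHom R m n).mapMatrix (Matrix.of fun a b => MvPolynomial.X (u a, v b))
      = (Matrix.of fun a c => MvPolynomial.X (rowVar (toLex (c, u a))) :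
          Matrix (Fin k) (Fin m) (MvPolynomial (FactorVar m n) R))
        * (Matrix.of fun c b => MvPolynomial.X (colVar (toLex (c, v b))) :
          Matrix (Fin m) (Fin k) (MvPolynomial (FactorVar m n) R)) := by
    ext1 a b
    simp [factorHom, Matrix.mul_apply]
  rw [AlgHom.map_det, h, det_mul_eq_sum]
  refine Finset.sum_congr rfl fun t _ => ?_
  have h1 : ∏ a, (MvPolynomial.X (rowVar (toLex (t.1 a, u (t.2 a)))) : MvPolynomial (FactorVar m n) R)
      = ∏ a, MvPolynomial.X (rowVar (toLex (t.1 (t.2⁻¹ a), u a))) := by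
    rw [← Equiv.prod_comp t.2 fun a => (MvPolynomial.X (rowVar (toLex (t.1 (t.2⁻¹ a), u a))) :
      MvPolynomial (FactorVar m n) R)]
    simp
  simp only [Matrix.of_apply, h1]
  rw [show ((Equiv.Perm.sign t.2 : ℤ) : MvPolynomial (FactorVar m n) R)
    = MvPolynomial.C ((Equiv.Perm.sign t.2 : ℤ) : R) by simp]
  simp only [MvPolynomial.X]
  rw [← MvPolynomial.monomial_sum_one, ← MvPolynomial.monomial_sum_one, MvPolynomial.monomial_mul,
    MvPolynomial.C_mul_monomial]
  simp

theorem monic_and_degree_factorHom_det {R : Type*} [CommRing R] [Nontrivial R] {m n k : ℕ}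
    {u : Fin k → Fin m} {v : Fin k → Fin n} (hu : StrictMono u) (hv : StrictMono v) (hk : k ≤ m) :
    (factorOrder m n).Monic
      (factorHom R m n (Matrix.det (Matrix.of fun a b => MvPolynomial.X (u a, v b)))) ∧
    (factorOrder m n).degree
      (factorHom R m n (Matrix.det (Matrix.of fun a b => MvPolynomial.X (u a, v b))))
      = (∑ a, Finsupp.single (rowVar (toLex (Fin.castLE hk a, u a))) 1)
          + ∑ a, Finsupp.single (colVar (toLex (Fin.castLE hk a, v a))) 1 := by
  classical
  rw [factorHom_det]
  have := monic_and_degree_sum_monomial (R := R) (factorOrder m n)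
    {t : (Fin k → Fin m) × Equiv.Perm (Fin k) | Function.Injective t.1}
    (fun t => (∑ a, Finsupp.single (rowVar (toLex (t.1 (t.2⁻¹ a), u a))) 1)
          + ∑ a, Finsupp.single (colVar (toLex (t.1 a, v a))) 1)
    (fun t => ((Equiv.Perm.sign t.2 : ℤ) : R)) (t₀ := (Fin.castLE hk, 1))
    (by simpa using Fin.castLE_injective hk) (by simp) ?_
  · simpa using this
  · rintro ⟨w, s⟩ hw hne
    replace hw : Function.Injective w := by simpa using hw
    have hrow := fun h => toLex_sum_single_lt (rowVar (n := n)) rowVar_strictMono hk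
      (f := fun a => w (s⁻¹ a)) (hw.comp (Equiv.injective _)) hu h
    have hcol := fun h => toLex_sum_single_lt (colVar (m := m)) colVar_strictMono hk hw hv h
    rw [map_add, map_add]
    by_cases h1 : w = Fin.castLE hk
    · subst h1
      refine add_lt_add_of_lt_of_le (hrow fun h => hne ?_) le_rfl
      have : s⁻¹ = 1 := by
        ext a
        simpa using congrArg Fin.val (congrFun h a)
      rw [inv_eq_one.1 this]
    · by_cases h2 : (fun a => w (s⁻¹ a)) = Fin.castLE hk
      · refine add_lt_add_of_le_of_lt (le_of_eq ?_) (hcol h1)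
        exact congrArg _ (Finset.sum_congr rfl fun a _ =>
          congrArg (fun x => Finsupp.single (rowVar (toLex (x, u a))) 1) (congrFun h2 a))
      · exact add_lt_add (hrow h2) (hcol h1)

theorem sum_single_castLE_apply {V : Type*} {k r s : ℕ} {e : Fin r ×ₗ Fin s → V}
    (he : Function.Injective e) (hk : k ≤ r) (g : Fin k → Fin s) (a : Fin r) (i : Fin s) :
    (∑ b, Finsupp.single (e (toLex (Fin.castLE hk b, g b))) 1 : V →₀ ℕ) (e (toLex (a, i)))
      = if (List.ofFn g)[a.1]? = some i then 1 else 0 := by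
  classical
  simp only [Finsupp.finsetSum_apply, Finsupp.single_apply, he.eq_iff, EmbeddingLike.apply_eq_iff_eq,
    Prod.mk.injEq]
  by_cases ha : a.1 < k
  · rw [Finset.sum_eq_single ⟨a.1, ha⟩]
    · simp [ha]
    · intro b _ hb
      rw [if_neg]
      rintro ⟨h, -⟩
      exact hb (Fin.ext (congrArg Fin.val h : (Fin.castLE hk b).1 = a.1))
    · simp
  · rw [List.getElem?_eq_none (by simpa using ha)]
    refine Finset.sum_eq_zero fun b _ => ?_
    rw [if_neg]
    rintro ⟨h, -⟩
    exact ha ((congrArg Fin.val h) ▸ b.2)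

theorem sum_single_apply_of_ne {V ι : Type*} [Fintype ι] {g : ι → V} {v : V}
    (h : ∀ b, g b ≠ v) : (∑ b, Finsupp.single (g b) 1 : V →₀ ℕ) v = 0 := by
  classical
  simp [Finsupp.finsetSum_apply, h]

theorem monic_and_degree_factorHom_minorOver {R : Type*} [CommRing R] [Nontrivial R] {m n : ℕ}
    {u : List (Fin m)} {v : List (Fin n)} (hu : u.Pairwise (· < ·)) (hv : v.Pairwise (· < ·))
    (h : u.length = v.length) :
    (factorOrder m n).Monic (factorHom R m n (minorOver R u v)) ∧
    (∀ a i, (factorOrder m n).degree (factorHom R m n (minorOver R u v)) (rowVar (toLex (a, i)))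
      = if u[a.1]? = some i then 1 else 0) ∧
    (∀ a j, (factorOrder m n).degree (factorHom R m n (minorOver R u v)) (colVar (toLex (a, j)))
      = if v[a.1]? = some j then 1 else 0) := by
  have hu' : StrictMono u.get := List.sortedLT_iff_strictMono_get.1 hu.sortedLT
  have hv' : StrictMono v.get := List.sortedLT_iff_strictMono_get.1 hv.sortedLT
  have hk : u.length ≤ m := by simpa using Fintype.card_le_of_injective _ hu'.injective
  obtain ⟨h1, h2⟩ := monic_and_degree_factorHom_det (R := R) (n := n) hu'
    (v := fun b => v.get (Fin.cast h b)) (fun a b hab => hv' hab) hk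
  have hv2 : (List.ofFn fun b => v.get (Fin.cast h b)) = v := by
    apply List.ext_get
    · simp [h]
    · intro k h1 h2
      simp
  unfold minorOver
  rw [dif_pos h]
  refine ⟨h1, fun a i => ?_, fun a j => ?_⟩
  · rw [h2, Finsupp.add_apply, sum_single_castLE_apply rowVar_strictMono.injective,
      sum_single_apply_of_ne fun b => (rowVar_ne_colVar _ _).symm, List.ofFn_get, add_zero]
  · rw [h2, Finsupp.add_apply, sum_single_castLE_apply colVar_strictMono.injective,
      sum_single_apply_of_ne fun b => rowVar_ne_colVar _ _, hv2, zero_add]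

theorem monic_and_degree_factorHom_bitableauOver {k : Type*} [Field k] {m n : ℕ}
    {P : List (List (Fin m))} {Q : List (List (Fin n))} (hP : IsTableau P) (hQ : IsTableau Q)
    (h : P.map List.length = Q.map List.length) :
    (factorOrder m n).Monic (factorHom k m n (bitableauOver k (P, Q))) ∧
    (∀ a i, (factorOrder m n).degree (factorHom k m n (bitableauOver k (P, Q)))
      (rowVar (toLex (a, i))) = (P[a.1]?.getD []).count i) ∧
    (∀ a j, (factorOrder m n).degree (factorHom k m n (bitableauOver k (P, Q)))
      (colVar (toLex (a, j))) = (Q[a.1]?.getD []).count j) := by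
  have hc := fun c => monic_and_degree_factorHom_minorOver (R := k) (hP.column_pairwise c)
    (hQ.column_pairwise c) (length_column_eq h c)
  have hw : width P = width Q := by simp [width, h]
  unfold bitableauOver
  rw [map_prod]
  refine ⟨MonomialOrder.Monic.prod fun c _ => (hc c).1, fun a i => ?_, fun a j => ?_⟩
  · rw [MonomialOrder.degree_prod fun c _ => (hc c).1.ne_zero, Finsupp.finsetSum_apply,
      ← hP.sum_ite_column]
    exact Finset.sum_congr rfl fun c _ => (hc c).2.1 a i
  · rw [MonomialOrder.degree_prod fun c _ => (hc c).1.ne_zero, Finsupp.finsetSum_apply,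
      ← hQ.sum_ite_column, ← hw]
    exact Finset.sum_congr rfl fun c _ => (hc c).2.2 a j

theorem length_eq_of_shape {m n : ℕ} {P : List (List (Fin m))} {Q : List (List (Fin n))}
    (h : P.map List.length = Q.map List.length) : P.length = Q.length := by
  simpa using congrArg List.length h

/-- The bitableaux of the pairs of tableaux that correspond to matrices are linearly independent
over every field. -/
theorem linearIndependent_bitableauOver_rsk (k : Type*) [Field k] (m n : ℕ) :
    LinearIndependent k fun α : ExpMat m n => bitableauOver k (rsk α) := by
  have hP : ∀ α : ExpMat m n, IsTableau (rsk α).1 := fun α =>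
    foldl_insertBiletter_fst_isTableau _
  have hQ : ∀ α : ExpMat m n, IsTableau (rsk α).2 := fun α =>
    foldl_insertBiletter_snd_isTableau (biword_pairwise α)
  have hs : ∀ α : ExpMat m n, (rsk α).1.map List.length = (rsk α).2.map List.length := fun α =>
    foldl_insertBiletter_shape _
  have key := fun α : ExpMat m n =>
    monic_and_degree_factorHom_bitableauOver (k := k) (hP α) (hQ α) (hs α)
  refine LinearIndependent.of_comp (factorHom k m n).toLinearMap ?_
  refine linearIndependent_of_degree_injective (factorOrder m n) _ (fun α => (key α).1) ?_
  intro α β h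
  have h' : (factorOrder m n).degree (factorHom k m n (bitableauOver k (rsk α)))
    = (factorOrder m n).degree (factorHom k m n (bitableauOver k (rsk β))) := h
  have hnone : ∀ (γ : ExpMat m n) {a : ℕ}, ¬ a < m → (rsk γ).1[a]? = none ∧ (rsk γ).2[a]? = none := by
    intro γ a ha
    have h1 := (hP γ).length_le
    have h2 := length_eq_of_shape (hs γ)
    exact ⟨List.getElem?_eq_none (by omega), List.getElem?_eq_none (by omega)⟩
  apply rsk_injective
  refine Prod.ext ((hP α).eq_of_count (hP β) fun a i => ?_)
    ((hQ α).eq_of_count (hQ β) fun a j => ?_)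
  · by_cases ha : a < m
    · exact ((key α).2.1 ⟨a, ha⟩ i).symm.trans ((DFunLike.congr_fun h' _).trans ((key β).2.1 _ _))
    · rw [(hnone α ha).1, (hnone β ha).1]
  · by_cases ha : a < m
    · exact ((key α).2.2 ⟨a, ha⟩ j).symm.trans ((DFunLike.congr_fun h' _).trans ((key β).2.2 _ _))
    · rw [(hnone α ha).2, (hnone β ha).2]

/-! ### The integer matrix of the restricted operator -/

theorem rskOp_monomial {m n : ℕ} (α : ExpMat m n) :
    rskOp m n (MvPolynomial.monomial α 1) = bitableau (rsk α) := by
  have := (MvPolynomial.basisMonomials (Fin m × Fin n) ℂ).constr_basis ℂ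
    (fun α => bitableau (rsk α)) α
  simpa [rskOp] using this

theorem finite_isCont {m n : ℕ} (σ : Fin m → ℕ) (π : Fin n → ℕ) :
    Finite {α : ExpMat m n // IsCont σ π α} := by
  classical
  refine Set.Finite.subset (Set.finite_Iic (Finsupp.equivFunOnFinite.symm fun b => σ b.1))
    fun α hα b => ?_
  have := hα.1 b.1
  simp only [Finsupp.equivFunOnFinite_symm_apply_apply]
  rw [← this]
  exact Finset.single_le_sum (f := fun j => α (b.1, j)) (fun _ _ => Nat.zero_le _)
    (Finset.mem_univ b.2)

theorem isCont_of_mem_support {m n : ℕ} {σ : Fin m → ℕ} {π : Fin n → ℕ}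
    {f : MvPolynomial (Fin m × Fin n) ℂ} (hf : f ∈ weightSpace σ π) {α : ExpMat m n}
    (hα : f.coeff α ≠ 0) : IsCont σ π α := by
  induction hf using Submodule.span_induction with
  | mem f h =>
    obtain ⟨β, hβ, rfl⟩ := h
    rw [MvPolynomial.coeff_monomial] at hα
    split_ifs at hα with h
    · exact h ▸ hβ
    · exact absurd rfl hα
  | zero => simp at hα
  | add x y _ _ hx hy =>
    rw [MvPolynomial.coeff_add] at hα
    by_cases h : x.coeff α = 0
    · exact hy fun h' => hα (by rw [h, h', add_zero])
    · exact hx h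
  | smul c x _ hx =>
    rw [MvPolynomial.coeff_smul] at hα
    exact hx fun h => hα (by rw [h, smul_zero])

/-- The matrix of the restricted operator with respect to the monomials. -/
noncomputable def rskMatrix {m n : ℕ} (σ : Fin m → ℕ) (π : Fin n → ℕ) :
    Matrix {α : ExpMat m n // IsCont σ π α} {α : ExpMat m n // IsCont σ π α} ℤ :=
  Matrix.of fun α β => (bitableauOver ℤ (rsk β.1)).coeff α.1

theorem coeff_bitableauOver (R : Type*) [CommRing R] {m n : ℕ}
    (PQ : List (List (Fin m)) × List (List (Fin n))) (α : ExpMat m n) :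
    (bitableauOver R PQ).coeff α = (((bitableauOver ℤ PQ).coeff α : ℤ) : R) := by
  rw [← map_bitableauOver (Int.castRingHom R), MvPolynomial.coeff_map]
  rfl

theorem coeff_bitableauOver_eq_zero (R : Type*) [CommRing R] {m n : ℕ} {σ : Fin m → ℕ}
    {π : Fin n → ℕ} {α β : ExpMat m n} (hβ : IsCont σ π β) (hα : ¬ IsCont σ π α) :
    (bitableauOver R (rsk β)).coeff α = 0 := by
  have h : (bitableauOver ℂ (rsk β)).coeff α = 0 := by
    by_contra h
    exact hα (isCont_of_mem_support (bitableau_rsk_mem hβ) h)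
  rw [coeff_bitableauOver, Int.cast_eq_zero] at h
  rw [coeff_bitableauOver, h, Int.cast_zero]

theorem map_rskMatrix_mulVec_injective {m n : ℕ} (σ : Fin m → ℕ) (π : Fin n → ℕ)
    [Fintype {α : ExpMat m n // IsCont σ π α}] (k : Type*) [Field k]
    {c : {α : ExpMat m n // IsCont σ π α} → k}
    (hc : ((rskMatrix σ π).map (Int.cast : ℤ → k)).mulVec c = 0) : c = 0 := by
  have hli := (linearIndependent_bitableauOver_rsk k m n).comp
    (Subtype.val : {α : ExpMat m n // IsCont σ π α} → ExpMat m n) Subtype.val_injective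
  rw [Fintype.linearIndependent_iff] at hli
  refine funext fun β => hli c ?_ β
  ext α
  simp only [MvPolynomial.coeff_sum, MvPolynomial.coeff_smul, Function.comp_apply, smul_eq_mul,
    MvPolynomial.coeff_zero]
  by_cases hα : IsCont σ π α
  · have := congrFun hc ⟨α, hα⟩
    simp only [Matrix.mulVec, dotProduct, rskMatrix, Matrix.map_apply, Matrix.of_apply,
      Pi.zero_apply] at this
    rw [← this]
    exact Finset.sum_congr rfl fun β _ => by rw [coeff_bitableauOver, mul_comm]
  · exact Finset.sum_eq_zero fun β _ => by
      rw [coeff_bitableauOver_eq_zero k β.2 hα, mul_zero]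

theorem eq_sum_monomial_of_mem_weightSpace {m n : ℕ} {σ : Fin m → ℕ} {π : Fin n → ℕ}
    [Fintype {α : ExpMat m n // IsCont σ π α}]
    {f : MvPolynomial (Fin m × Fin n) ℂ} (hf : f ∈ weightSpace σ π) :
    f = ∑ β : {α : ExpMat m n // IsCont σ π α}, f.coeff β.1 • MvPolynomial.monomial β.1 1 := by
  classical
  ext α
  simp only [MvPolynomial.coeff_sum, MvPolynomial.coeff_smul, MvPolynomial.coeff_monomial,
    smul_eq_mul, mul_ite, mul_one, mul_zero]
  by_cases hα : IsCont σ π α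
  · rw [Finset.sum_eq_single ⟨α, hα⟩]
    · simp
    · rintro β - hβ
      exact if_neg fun h => hβ (Subtype.ext h)
    · simp
  · rw [Finset.sum_eq_zero]
    · by_contra h
      exact hα (isCont_of_mem_support hf h)
    · exact fun β _ => if_neg fun (h : β.1 = α) => hα (h ▸ β.2)

theorem mulVec_rskMatrix_coeff {m n : ℕ} {σ : Fin m → ℕ} {π : Fin n → ℕ}
    [Fintype {α : ExpMat m n // IsCont σ π α}]
    {f : MvPolynomial (Fin m × Fin n) ℂ} (hf : f ∈ weightSpace σ π) :
    ((rskMatrix σ π).map (Int.cast : ℤ → ℂ)).mulVec (fun β => f.coeff β.1)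
      = fun α => (rskOp m n f).coeff α.1 := by
  funext α
  conv_rhs => rw [eq_sum_monomial_of_mem_weightSpace hf]
  simp only [map_sum, map_smul, rskOp_monomial, MvPolynomial.coeff_sum, MvPolynomial.coeff_smul,
    smul_eq_mul, Matrix.mulVec, dotProduct, rskMatrix, Matrix.map_apply, Matrix.of_apply]
  exact Finset.sum_congr rfl fun β _ => by
    rw [← bitableauOver_complex, coeff_bitableauOver ℂ, mul_comm]

/-- Every rational eigenvalue of an integer matrix that is injective modulo every prime number is
`1` or `-1`. -/
theorem rat_eigenvalue_eq_one_or {ι : Type*} [Fintype ι] (M : Matrix ι ι ℤ)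
    (hM : ∀ p : ℕ, p.Prime → ∀ c : ι → ZMod p,
      (M.map (Int.cast : ℤ → ZMod p)).mulVec c = 0 → c = 0)
    {q : ℚ} {c : ι → ℂ} (hc : c ≠ 0)
    (hq : (M.map (Int.cast : ℤ → ℂ)).mulVec c = (q : ℂ) • c) : q = 1 ∨ q = -1 := by
  classical
  have hdet : ∀ {K : Type} [CommRing K] (x : K),
      Polynomial.eval x (M.map (Int.cast : ℤ → K)).charpoly
        = Polynomial.eval₂ (Int.castRingHom K) x M.charpoly := by
    intro K _ x
    rw [← Polynomial.eval_map, ← Matrix.charpoly_map]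
    rfl
  have hroot : Polynomial.eval₂ (Int.castRingHom ℂ) (q : ℂ) M.charpoly = 0 := by
    rw [← hdet, Matrix.eval_charpoly]
    refine Matrix.exists_mulVec_eq_zero_iff.1 ⟨c, hc, ?_⟩
    rw [Matrix.sub_mulVec, hq, Matrix.scalar_apply, sub_eq_zero]
    ext i
    simp [Matrix.mulVec_diagonal]
  have hrootQ : Polynomial.aeval q M.charpoly = 0 := by
    apply (algebraMap ℚ ℂ).injective
    rw [map_zero, ← hroot, ← Polynomial.aeval_algebraMap_apply, Polynomial.aeval_def]
    rfl
  obtain ⟨z, hz⟩ := isInteger_of_is_root_of_monic (Matrix.charpoly_monic M) hrootQ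
  have hzq : (z : ℚ) = q := hz
  have hrootZ : Polynomial.eval z M.charpoly = 0 := by
    apply (algebraMap ℤ ℚ).injective_int
    rw [map_zero, ← hrootQ, ← hzq]
    simp [Polynomial.aeval_def, Polynomial.eval₂_at_intCast]
  have hunit : z.natAbs = 1 := by
    by_contra hne
    obtain ⟨p, hp, hpz⟩ := Nat.exists_prime_and_dvd hne
    have := Fact.mk hp
    have hz0 : (z : ZMod p) = 0 :=
      (ZMod.intCast_zmod_eq_zero_iff_dvd z p).2 (Int.natCast_dvd.2 hpz)
    have h0 : Polynomial.eval (0 : ZMod p) (M.map (Int.cast : ℤ → ZMod p)).charpoly = 0 := by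
      rw [hdet]
      have := Polynomial.hom_eval₂ M.charpoly (RingHom.id ℤ) (Int.castRingHom (ZMod p)) z
      rw [← Polynomial.eval, hrootZ] at this
      simpa [hz0] using this.symm
    rw [Matrix.eval_charpoly] at h0
    obtain ⟨v, hv, hv0⟩ := Matrix.exists_mulVec_eq_zero_iff.2 h0
    refine hv (hM p hp v ?_)
    simpa [Matrix.neg_mulVec] using hv0
  rcases Int.natAbs_eq_iff.1 hunit with h | h <;> rw [← hzq, h] <;> simp

theorem rskWeight_rat_eigenvalue {m n : ℕ} (σ : Fin m → ℕ) (π : Fin n → ℕ) (q : ℚ)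
    (h : (rskWeight σ π).HasEigenvalue (q : ℂ)) : q = 1 ∨ q = -1 := by
  have := finite_isCont σ π
  have := Fintype.ofFinite {α : ExpMat m n // IsCont σ π α}
  obtain ⟨f, hf⟩ := h.exists_hasEigenvector
  have hfq : rskOp m n f.1 = (q : ℂ) • f.1 := congrArg Subtype.val hf.apply_eq_smul
  refine rat_eigenvalue_eq_one_or (rskMatrix σ π)
    (fun p hp c hc => have := Fact.mk hp; map_rskMatrix_mulVec_injective σ π (ZMod p) hc)
    (c := fun β => f.1.coeff β.1) (fun h0 => hf.2 (Subtype.ext ?_)) ?_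
  · rw [eq_sum_monomial_of_mem_weightSpace f.2]
    exact Finset.sum_eq_zero fun β _ => by rw [show f.1.coeff β.1 = 0 from congrFun h0 β, zero_smul]
  · rw [mulVec_rskMatrix_coeff f.2, hfq]
    ext β
    simp

/-! ### The canonical contingency table -/

theorem length_le_insertTableau {m : ℕ} (p : Fin m) (T : List (List (Fin m))) :
    T.length ≤ (insertTableau p T).1.length := by
  induction T generalizing p with
  | nil => simp
  | cons R T ih =>
    cases h : (insertRow p R).2 with
    | none => simp [insertTableau_cons_of_none T h]
    | some x => simpa [insertTableau_cons_of_some T h] using ih x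

/-- The pairs of tableaux with at most one row correspond to biwords with weakly increasing first
letters. -/
theorem foldl_insertBiletter_of_length_le_one {m n : ℕ} {w : List (Fin m × Fin n)}
    (h : (w.foldl insertBiletter ([], [])).1.length ≤ 1) :
    (w.map Prod.fst).Pairwise (· ≤ ·) := by
  have key : ∀ w : List (Fin m × Fin n), (w.foldl insertBiletter ([], [])).1.length ≤ 1 →
      (w.map Prod.fst).Pairwise (· ≤ ·) ∧
      ∀ R ∈ (w.foldl insertBiletter ([], [])).1, R = w.map Prod.fst := by
    intro w h
    induction w using List.reverseRecOn with
    | nil => simp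
    | append_singleton w b ih =>
      have hperm := (foldl_insert (w ++ [b]) ([], []) rfl).2.1
      rw [List.foldl_append] at h hperm ⊢
      obtain ⟨ih1, ih2⟩ := ih ((length_le_insertTableau b.1 _).trans h)
      simp only [List.foldl_cons, List.foldl_nil, insertBiletter] at h ⊢
      have hpermw := (foldl_insert w ([], []) rfl).2.1
      generalize (w.foldl insertBiletter ([], [])).1 = P at *
      cases P with
      | nil =>
        have hw : w = [] := by simpa using hpermw.length_eq.symm
        subst hw
        simp [insertTableau_nil]
      | cons R P =>
        obtain rfl := ih2 R (by simp)
        cases hr : (insertRow b.1 (w.map Prod.fst)).2 with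
        | none =>
          rw [insertTableau_cons_of_none P hr] at h ⊢
          obtain rfl : P = [] := by simpa using h
          refine ⟨?_, by simp⟩
          rw [List.map_append, List.pairwise_append]
          refine ⟨ih1, by simp, fun x hx y hy => ?_⟩
          obtain rfl : y = b.1 := by simpa using hy
          exact forall_le_of_insertRow_snd_eq_none hr x hx
        | some x =>
          rw [insertTableau_cons_of_some P hr] at h
          have : (insertTableau x P).1 = [] := by simpa using h
          have := (insertTableau_perm x P).length_eq
          simp_all
  exact (key w h).1

theorem foldl_insertBiletter_of_pairwise {m n : ℕ} {w : List (Fin m × Fin n)} (hw : w ≠ [])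
    (h : (w.map Prod.fst).Pairwise (· ≤ ·)) :
    w.foldl insertBiletter ([], []) = ([w.map Prod.fst], [w.map Prod.snd]) := by
  induction w using List.reverseRecOn with
  | nil => exact absurd rfl hw
  | append_singleton w b ih =>
    rw [List.foldl_append]
    by_cases h0 : w = []
    · subst h0
      rfl
    · rw [List.map_append, List.pairwise_append] at h
      rw [ih h0 h.1]
      have hr : (insertRow b.1 (w.map Prod.fst)).2 = none := by
        rw [insertRow_of_forall_le fun x hx => h.2.2 x hx b.1 (by simp)]
      simp [insertBiletter, insertTableau_cons_of_none [] hr, addBox]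

theorem minor_singleton {m n : ℕ} (i : Fin m) (j : Fin n) :
    minor [i] [j] = MvPolynomial.X (i, j) := by
  unfold minor
  rw [dif_pos (show [i].length = [j].length from rfl)]
  exact Matrix.det_fin_one _

theorem prod_X_biword {m n : ℕ} (α : ExpMat m n) :
    ((biword α).map fun b => (MvPolynomial.X b : MvPolynomial (Fin m × Fin n) ℂ)).prod
      = MvPolynomial.monomial α 1 := by
  classical
  have hcount : ∀ b, @List.count _ instBEqOfDecidableEq b (biword α) = α b := by
    intro b
    rw [← count_biword]
    congr
    exact lawful_beq_subsingleton _ _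
  rw [Finset.prod_list_map_count, MvPolynomial.monomial_eq, map_one, one_mul, Finsupp.prod]
  refine Finset.prod_congr ?_ fun b _ => by rw [hcount]
  ext b
  rw [List.mem_toFinset, ← List.count_pos_iff, count_biword, Finsupp.mem_support_iff, pos_iff_ne_zero]

theorem bitableau_singleton {m n : ℕ} (w : List (Fin m × Fin n)) :
    bitableau ([w.map Prod.fst], [w.map Prod.snd])
      = (w.map fun b => (MvPolynomial.X b : MvPolynomial (Fin m × Fin n) ℂ)).prod := by
  have hw : width [w.map Prod.fst] = w.length := by simp [width]
  rw [bitableau, hw, ← Fin.prod_univ_eq_prod_range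
    (fun c => minor (column [w.map Prod.fst] c) (column [w.map Prod.snd] c)), ← List.prod_ofFn]
  congr 1
  apply List.ext_getElem
  · simp
  · intro c h1 h2
    simp [column, minor_singleton]

theorem bitableau_rsk_of_pairwise {m n : ℕ} {α : ExpMat m n}
    (h : ((biword α).map Prod.fst).Pairwise (· ≤ ·)) :
    bitableau (rsk α) = MvPolynomial.monomial α 1 := by
  rw [← prod_X_biword]
  by_cases h0 : biword α = []
  · simp [rsk, h0, bitableau, width]
  · rw [rsk, foldl_insertBiletter_of_pairwise h0 h, bitableau_singleton]

theorem isCanonical_iff {m n : ℕ} {σ : Fin m → ℕ} {π : Fin n → ℕ} {α : ExpMat m n} :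
    IsCanonical σ π α ↔ IsCont σ π α ∧ ((biword α).map Prod.fst).Pairwise (· ≤ ·) := by
  refine and_congr_right fun _ => ⟨fun h => foldl_insertBiletter_of_length_le_one h.1, fun h => ?_⟩
  by_cases h0 : biword α = []
  · simp [rsk, h0]
  · simp [rsk, foldl_insertBiletter_of_pairwise h0 h]

/-- The weakly increasing word with prescribed content. -/
def sortedWord {m : ℕ} (σ : Fin m → ℕ) : List (Fin m) :=
  (List.finRange m).flatMap fun i => List.replicate (σ i) i

theorem sortedWord_pairwise {m : ℕ} (σ : Fin m → ℕ) : (sortedWord σ).Pairwise (· ≤ ·) := by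
  unfold sortedWord
  rw [List.pairwise_flatMap]
  refine ⟨fun i _ => List.pairwise_replicate.2 (.inr le_rfl),
    (List.pairwise_lt_finRange m).imp fun {i i'} hii' x hx y hy => ?_⟩
  rw [List.eq_of_mem_replicate hx, List.eq_of_mem_replicate hy]
  exact hii'.le

theorem count_sortedWord {m : ℕ} (σ : Fin m → ℕ) (i : Fin m) : (sortedWord σ).count i = σ i := by
  simp only [sortedWord, List.count_flatMap, List.count_replicate, Function.comp_def, beq_iff_eq]
  rw [← List.ofFn_eq_map, List.sum_ofFn]
  simp

theorem length_sortedWord {m : ℕ} (σ : Fin m → ℕ) : (sortedWord σ).length = ∑ i, σ i := by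
  simp only [sortedWord, List.length_flatMap, List.length_replicate]
  rw [← List.ofFn_eq_map, List.sum_ofFn]

theorem eq_sortedWord {m : ℕ} {σ : Fin m → ℕ} {u : List (Fin m)} (hu : u.Pairwise (· ≤ ·))
    (h : ∀ i, u.count i = σ i) : u = sortedWord σ :=
  List.Perm.eq_of_pairwise (fun _ _ _ _ => le_antisymm) hu (sortedWord_pairwise σ)
    (List.perm_iff_count.2 fun i => by rw [h, count_sortedWord])

theorem biword_snd_pairwise {m n : ℕ} (α : ExpMat m n) :
    ((biword α).map Prod.snd).Pairwise (· ≤ ·) :=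
  List.pairwise_map.2 ((biword_pairwise α).imp BiletterLE.snd_le)

theorem IsCanonical.biword_eq {m n : ℕ} {σ : Fin m → ℕ} {π : Fin n → ℕ} {α : ExpMat m n}
    (h : IsCanonical σ π α) : biword α = (sortedWord σ).zip (sortedWord π) := by
  obtain ⟨hα, hp⟩ := isCanonical_iff.1 h
  exact List.zip_of_prod (eq_sortedWord hp fun i => (count_fst_biword α i).trans (hα.1 i))
    (eq_sortedWord (biword_snd_pairwise α) fun j => (count_snd_biword α j).trans (hα.2 j))

theorem biword_eq_of_pairwise {m n : ℕ} {α : ExpMat m n} {w : List (Fin m × Fin n)}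
    (hw : w.Pairwise BiletterLE) (h : ∀ b, w.count b = α b) : biword α = w := by
  refine List.Perm.eq_of_pairwise (fun a b _ _ hab hba => ?_) (biword_pairwise α) hw
    (List.perm_iff_count.2 fun b => by rw [h, count_biword])
  have h2 : a.2 = b.2 := le_antisymm hab.snd_le hba.snd_le
  refine Prod.ext (le_antisymm ?_ ?_) h2
  · exact (hab.resolve_left (by simp [h2])).2
  · exact (hba.resolve_left (by simp [h2])).2

theorem exists_isCanonical {m n : ℕ} {σ : Fin m → ℕ} {π : Fin n → ℕ}
    (h : ∑ i, σ i = ∑ j, π j) : ∃ α : ExpMat m n, IsCanonical σ π α := by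
  set w := (sortedWord σ).zip (sortedWord π) with hw
  have hlen : (sortedWord σ).length = (sortedWord π).length := by
    rw [length_sortedWord, length_sortedWord, h]
  have hfst : w.map Prod.fst = sortedWord σ := List.map_fst_zip hlen.le
  have hsnd : w.map Prod.snd = sortedWord π := List.map_snd_zip hlen.ge
  have hpw : w.Pairwise BiletterLE := by
    have h1 := List.pairwise_map.1 (hfst ▸ sortedWord_pairwise σ)
    have h2 := List.pairwise_map.1 (hsnd ▸ sortedWord_pairwise π)
    exact h1.imp₂ (fun a b hab hab' => (lt_or_eq_of_le hab').imp id fun h => ⟨h, hab⟩) h2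
  set α : ExpMat m n := Finsupp.equivFunOnFinite.symm fun b => w.count b with hα
  have hbw : biword α = w := biword_eq_of_pairwise hpw fun b => rfl
  refine ⟨α, isCanonical_iff.2 ⟨⟨fun i => ?_, fun j => ?_⟩, ?_⟩⟩
  · rw [← count_fst_biword, hbw, hfst, count_sortedWord]
  · rw [← count_snd_biword, hbw, hsnd, count_sortedWord]
  · rw [hbw, hfst]
    exact sortedWord_pairwise σ

theorem IsCanonical.hasEigenvector {m n : ℕ} {σ : Fin m → ℕ} {π : Fin n → ℕ} {α : ExpMat m n}
    (hα : IsCanonical σ π α) : (rskWeight σ π).HasEigenvector 1 (contMonomial α hα.1) := by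
  refine ⟨Module.End.mem_eigenspace_iff.2 (Subtype.ext ?_), fun h => ?_⟩
  · rw [one_smul]
    change rskOp m n (MvPolynomial.monomial α 1) = MvPolynomial.monomial α 1
    rw [rskOp_monomial, bitableau_rsk_of_pairwise (isCanonical_iff.1 hα).2]
  · have : (MvPolynomial.monomial α 1 : MvPolynomial (Fin m × Fin n) ℂ) = 0 :=
      congrArg Subtype.val h
    simp at this

end RSKOp

theorem proposition4p3 {m n d : ℕ} (σ : Fin m → ℕ) (π : Fin n → ℕ)
    (h : RSKOp.IsReducedPair d σ π) :
    (∀ q : ℚ, (RSKOp.rskWeight σ π).HasEigenvalue (q : ℂ) → q = 1 ∨ q = -1) ∧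
    (RSKOp.rskWeight σ π).HasEigenvalue 1 ∧
    (∃! α : RSKOp.ExpMat m n, RSKOp.IsCanonical σ π α) ∧
    (∀ (α : RSKOp.ExpMat m n) (hα : RSKOp.IsCanonical σ π α),
      (RSKOp.rskWeight σ π).HasEigenvector 1 (RSKOp.contMonomial α hα.1)) := by
  obtain ⟨α, hα⟩ := RSKOp.exists_isCanonical (h.sum_left.trans h.sum_right.symm)
  exact ⟨RSKOp.rskWeight_rat_eigenvalue σ π,
    Module.End.hasEigenvalue_of_hasEigenvector hα.hasEigenvector,
    ⟨α, hα, fun β hβ => RSKOp.biword_injective (hβ.biword_eq.trans hα.biword_eq.symm)⟩,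
    fun β hβ => hβ.hasEigenvector⟩
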